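/- **Theorem 3.18.** Let $(M,I,J,K,g_M)$ be a hyperkähler manifold: $(M,g_M)$ is a smooth Riemannian manifold and $I,J,K$ are smooth sections of $\mathrm{End}(TM)$ such that $I^2=J^2=K^2=-\mathrm{id}$, $IJ=-JI=K$, and each $R\in\{I,J,K\}$ satisfies $g_M(RX,RY)=g_M(X,Y)$ and is parallel for the Levi-Civita connection $\nabla$ of $g_M$. Let $(N,g_N)$ be a Riemannian manifold, and let $F:M\to N$ be a horizontally conformal submersion with dilation $\lambda$: $F$ is smooth, each differential $(F_*)_p$ is surjective, $\lambda:M\to(0,\infty)$, and $g_N(F_*X,F_*Y)=\lambda(p)^2g_M(X,Y)$ for all $p\in M$ and $X,Y\in(\ker (F_*)_p)^\perp$. Assume that $F$ is an almost h-conformal slant submersion with almost h-conformal slant basis $(I,J,K)$: every point of $M$ has an open neighbourhood $U$ such that, for each $R\in\{I,J,K\}$, the angle between $RV$ and $\ker (F_*)_q$ is the same for all $q\in U$ and all nonzero $V\in\ker (F_*)_q$. Let $\mathcal V$ and $\mathcal H$ be the orthogonal projections of $TM$ onto $\ker F_*$ and $(\ker F_*)^\perp$. For $R\in\{I,J,K\}$,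 write $RV=\phi_RV+\omega_RV$ for $V\in\Gamma(\ker F_*)$, with $\phi_RV=\mathcal V RV$ and $\omega_RV=\mathcal H RV$, and write $C_RX=\mathcal H RX$ for $X\in\Gamma((\ker F_*)^\perp)$. For vector fields $X,Y$ on $M$ put $$\mathcal T_XY=\mathcal H\nabla_{\mathcal VX}\mathcal VY+\mathcal V\nabla_{\mathcal VX}\mathcal HY,\qquad \mathcal A_XY=\mathcal H\nabla_{\mathcal HX}\mathcal VY+\mathcal V\nabla_{\mathcal HX}\mathcal HY,$$ and $\widehat\nabla_VW=\mathcal V\nabla_VW$ for $V,W\in\Gamma(\ker F_*)$. The map $F$ is called totally geodesic if $(\nabla F_*)(X,Y):=\nabla^F_XF_*Y-F_*(\nabla_XY)=0$ for all $X,Y\in\Gamma(TM)$, where $\nabla^F$ is the pullback to $F^*TN$ of the Levi-Civita connection of $g_N$; and $F$ is called horizontally homothetic if the gradient of $\lambda$ is vertical, that is, $X\lambda=0$ for every horizontal vector $X$. For $R\in\{I,J,K\}$ consider the following condition. $(\ast_R)$ All three of the following hold: - (i) $C_R(\mathcal T_V\phi_RW+\mathcal H\nabla_V\omega_RW)+\omega_R(\widehat\nabla_V\phi_RW+\mathcal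 T_V\omega_RW)=0$ for all $V,W\in\Gamma(\ker F_*)$; - (ii) $F$ is horizontally homothetic; - (iii) $C_R(\mathcal A_X\phi_RV+\mathcal H\nabla_X\omega_RV)+\omega_R(\mathcal V\nabla_X\phi_RV+\mathcal A_X\omega_RV)=0$ for all $V\in\Gamma(\ker F_*)$ and $X\in\Gamma((\ker F_*)^\perp)$. Then the following are equivalent: (a) $F$ is a totally geodesic map; (b) $(\ast_I)$; (c) $(\ast_J)$; (d) $(\ast_K)$. -/

import Mathlib

open Bundle Set VectorField
open scoped Manifold ContDiff Topology

set_option linter.unusedSectionVars false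

noncomputable section

namespace HSlant

/-! ### The Levi-Civita connection of a Riemannian metric -/

section LC

variable {E : Type*} [NormedAddCommGroup E] [NormedSpace ℝ E] [FiniteDimensional ℝ E]
  {H : Type*} [TopologicalSpace H] {I : ModelWithCorners ℝ E H}
  {M : Type*} [TopologicalSpace M] [ChartedSpace H M] [IsManifold I ∞ M]

/-- Tangent spaces of a finite-dimensional manifold are finite-dimensional. -/
instance tangentFD (x : M) : FiniteDimensional ℝ (TangentSpace I x) :=
  inferInstanceAs (FiniteDimensional ℝ E)

variable (g : ContMDiffRiemannianMetric I ∞ E (fun x : M => TangentSpace I x))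

theorem mdiffAt_metric {X Y : Π x : M, TangentSpace I x} {x : M} (hX : MDiffAt (T% X) x)
    (hY : MDiffAt (T% Y) x) : MDiffAt (fun y => g.inner y (X y) (Y y)) x := by
  have : MDifferentiableAt I (I.prod 𝓘(ℝ))
      (fun m ↦ TotalSpace.mk' ℝ (E := Bundle.Trivial M ℝ) m (g.inner m (X m) (Y m))) x := by
    apply MDifferentiableAt.clm_bundle_apply₂ (F₁ := E) (F₂ := E)
    · exact (g.contMDiff.mdifferentiable (by simp)) x
    · exact hX
    · exact hY
  rw [mdifferentiableAt_totalSpace] at this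
  exact this.2

/-- The right-hand side of the Koszul formula for `g(∇_X σ, Z)`. -/
def koszul (σ X Z : Π x : M, TangentSpace I x) (x : M) : ℝ :=
  (1 / 2) * (d% (fun y => g.inner y (σ y) (Z y)) x (X x)
    + d% (fun y => g.inner y (X y) (Z y)) x (σ x)
    - d% (fun y => g.inner y (X y) (σ y)) x (Z x) + g.inner x (mlieBracket I X σ x) (Z x)
    - g.inner x (mlieBracket I X Z x) (σ x) - g.inner x (mlieBracket I σ Z x) (X x))

variable {g}

theorem koszul_smul_left {σ X Z : Π x : M, TangentSpace I x} {f : M → ℝ} {x : M}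
    (hσ : MDiffAt (T% σ) x) (hX : MDiffAt (T% X) x) (hZ : MDiffAt (T% Z) x) (hf : MDiffAt f x) :
    koszul g σ (f • X) Z x = f x * koszul g σ X Z x := by
  have e1 : d% (fun y => g.inner y ((f • X) y) (Z y)) x = f x • d% (fun y => g.inner y (X y) (Z y)) x
        + (g.inner x (X x) (Z x) : ℝ) • d% f x := by
    rw [← mvfderiv_fun_mul hf (mdiffAt_metric g hX hZ)]; simp
  have e2 : d% (fun y => g.inner y ((f • X) y) (σ y)) x = f x • d% (fun y => g.inner y (X y) (σ y)) x
        + (g.inner x (X x) (σ x) : ℝ) • d% f x := by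
    rw [← mvfderiv_fun_mul hf (mdiffAt_metric g hX hσ)]; simp
  simp only [koszul, e1, e2, mlieBracket_smul_left hf hX]
  simp
  ring

theorem koszul_add_left {σ X X' Z : Π x : M, TangentSpace I x} {x : M}
    (hσ : MDiffAt (T% σ) x) (hX : MDiffAt (T% X) x) (hX' : MDiffAt (T% X') x)
    (hZ : MDiffAt (T% Z) x)  :
    koszul g σ (X + X') Z x = koszul g σ X Z x + koszul g σ X' Z x := by
  have e1 : d% (fun y => g.inner y ((X + X') y) (Z y)) x = d% (fun y => g.inner y (X y) (Z y)) x
        + d% (fun y => g.inner y (X' y) (Z y)) x := by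
    rw [← mvfderiv_fun_add (mdiffAt_metric g hX hZ) (mdiffAt_metric g hX' hZ)]; simp
  have e2 : d% (fun y => g.inner y ((X + X') y) (σ y)) x = d% (fun y => g.inner y (X y) (σ y)) x
        + d% (fun y => g.inner y (X' y) (σ y)) x := by
    rw [← mvfderiv_fun_add (mdiffAt_metric g hX hσ) (mdiffAt_metric g hX' hσ)]; simp
  simp only [koszul, e1, e2, mlieBracket_add_left hX hX']
  simp
  ring

theorem koszul_smul_right {σ X Z : Π x : M, TangentSpace I x} {f : M → ℝ} {x : M}
    (hσ : MDiffAt (T% σ) x) (hX : MDiffAt (T% X) x) (hZ : MDiffAt (T% Z) x) (hf : MDiffAt f x) :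
    koszul g σ X (f • Z) x = f x * koszul g σ X Z x := by
  have e1 : d% (fun y => g.inner y (X y) ((f • Z) y)) x = f x • d% (fun y => g.inner y (X y) (Z y)) x
        + (g.inner x (X x) (Z x) : ℝ) • d% f x := by
    rw [← mvfderiv_fun_mul hf (mdiffAt_metric g hX hZ)]; simp
  have e2 : d% (fun y => g.inner y (σ y) ((f • Z) y)) x = f x • d% (fun y => g.inner y (σ y) (Z y)) x
        + (g.inner x (σ x) (Z x) : ℝ) • d% f x := by
    rw [← mvfderiv_fun_mul hf (mdiffAt_metric g hσ hZ)]; simp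
  simp only [koszul, e1, e2, mlieBracket_smul_right hf hZ]
  simp [g.symm x (Z x)]
  ring

theorem koszul_add_right {σ X Z Z' : Π x : M, TangentSpace I x} {x : M}
    (hσ : MDiffAt (T% σ) x) (hX : MDiffAt (T% X) x) (hZ : MDiffAt (T% Z) x)
    (hZ' : MDiffAt (T% Z') x)  :
    koszul g σ X (Z + Z') x = koszul g σ X Z x + koszul g σ X Z' x := by
  have e1 : d% (fun y => g.inner y (X y) ((Z + Z') y)) x = d% (fun y => g.inner y (X y) (Z y)) x
        + d% (fun y => g.inner y (X y) (Z' y)) x := by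
    rw [← mvfderiv_fun_add (mdiffAt_metric g hX hZ) (mdiffAt_metric g hX hZ')]; simp
  have e2 : d% (fun y => g.inner y (σ y) ((Z + Z') y)) x = d% (fun y => g.inner y (σ y) (Z y)) x
        + d% (fun y => g.inner y (σ y) (Z' y)) x := by
    rw [← mvfderiv_fun_add (mdiffAt_metric g hσ hZ) (mdiffAt_metric g hσ hZ')]; simp
  simp only [koszul, e1, e2, mlieBracket_add_right hZ hZ']
  simp
  ring

theorem koszul_smul_mid {σ X Z : Π x : M, TangentSpace I x} {f : M → ℝ} {x : M}
    (hσ : MDiffAt (T% σ) x) (hX : MDiffAt (T% X) x) (hZ : MDiffAt (T% Z) x) (hf : MDiffAt f x) :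
    koszul g (f • σ) X Z x = f x * koszul g σ X Z x + d% f x (X x) * g.inner x (σ x) (Z x) := by
  have e1 : d% (fun y => g.inner y (X y) ((f • σ) y)) x = f x • d% (fun y => g.inner y (X y) (σ y)) x
        + (g.inner x (X x) (σ x) : ℝ) • d% f x := by
    rw [← mvfderiv_fun_mul hf (mdiffAt_metric g hX hσ)]; simp
  have e2 : d% (fun y => g.inner y ((f • σ) y) (Z y)) x = f x • d% (fun y => g.inner y (σ y) (Z y)) x
        + (g.inner x (σ x) (Z x) : ℝ) • d% f x := by
    rw [← mvfderiv_fun_mul hf (mdiffAt_metric g hσ hZ)]; simp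
  simp only [koszul, e1, e2, mlieBracket_smul_right hf hσ, mlieBracket_smul_left hf hσ]
  simp [g.symm x (σ x) (X x)]
  ring

theorem koszul_add_mid {σ σ' X Z : Π x : M, TangentSpace I x} {x : M}
    (hσ : MDiffAt (T% σ) x) (hσ' : MDiffAt (T% σ') x) (hX : MDiffAt (T% X) x)
    (hZ : MDiffAt (T% Z) x)  :
    koszul g (σ + σ') X Z x = koszul g σ X Z x + koszul g σ' X Z x := by
  have e1 : d% (fun y => g.inner y (X y) ((σ + σ') y)) x = d% (fun y => g.inner y (X y) (σ y)) x
        + d% (fun y => g.inner y (X y) (σ' y)) x := by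
    rw [← mvfderiv_fun_add (mdiffAt_metric g hX hσ) (mdiffAt_metric g hX hσ')]; simp
  have e2 : d% (fun y => g.inner y ((σ + σ') y) (Z y)) x = d% (fun y => g.inner y (σ y) (Z y)) x
        + d% (fun y => g.inner y (σ' y) (Z y)) x := by
    rw [← mvfderiv_fun_add (mdiffAt_metric g hσ hZ) (mdiffAt_metric g hσ' hZ)]; simp
  simp only [koszul, e1, e2, mlieBracket_add_right hσ hσ', mlieBracket_add_left hσ hσ']
  simp
  ring

theorem metric_ext {x : M} {v w : TangentSpace I x} (h : ∀ z, g.inner x v z = g.inner x w z) :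
    v = w := by
  by_contra hne
  have h1 := g.pos x (v - w) (sub_ne_zero.2 hne)
  rw [map_sub] at h1
  simp [h] at h1

variable (g) in
/-- The metric at `x` as an isomorphism from the tangent space onto its dual. -/
def flat (x : M) : TangentSpace I x ≃ₗ[ℝ] (TangentSpace I x →ₗ[ℝ] ℝ) :=
  LinearEquiv.ofInjectiveOfFinrankEq
    ({ toFun := fun v => (g.inner x v : TangentSpace I x →ₗ[ℝ] ℝ)
       map_add' := by intro v w; ext z; simp
       map_smul' := by intro c v; ext z; simp } :
       TangentSpace I x →ₗ[ℝ] (TangentSpace I x →ₗ[ℝ] ℝ))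
    (fun v w h => metric_ext (g := g) fun z => by simpa using LinearMap.congr_fun h z)
    (by exact (Subspace.dual_finrank_eq (K := ℝ) (V := TangentSpace I x)).symm)

variable (g) in
theorem exists_koszul_cov {σ : Π x : M, TangentSpace I x} {x : M} (hσ : MDiffAt (T% σ) x) :
    ∃ A : TangentSpace I x →L[ℝ] TangentSpace I x,
      ∀ X Z : Π x : M, TangentSpace I x, MDiffAt (T% X) x → MDiffAt (T% Z) x →
        g.inner x (A (X x)) (Z x) = koszul g σ X Z x := by
  have h1 : ∀ Z : Π x : M, TangentSpace I x, MDiffAt (T% Z) x →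
    TensorialAt I E (fun X => koszul g σ X Z x) x := fun Z hZ =>
    ⟨fun hf hX => koszul_smul_left hσ hX hZ hf, fun hX hX' => koszul_add_left hσ hX hX' hZ⟩
  have h2 : ∀ X : Π x : M, TangentSpace I x, MDiffAt (T% X) x →
    TensorialAt I E (fun Z => koszul g σ X Z x) x := fun X hX =>
    ⟨fun hf hZ => koszul_smul_right hσ hX hZ hf, fun hZ hZ' => koszul_add_right hσ hX hZ hZ'⟩
  let B := TensorialAt.mkHom₂ (fun X Z => koszul g σ X Z x) x h1 h2
  let A : TangentSpace I x →ₗ[ℝ] TangentSpace I x :=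
    { toFun := fun v => (flat g x).symm (B v : TangentSpace I x →ₗ[ℝ] ℝ)
      map_add' := by
        intro v w
        rw [← map_add]; congr 1; ext z; simp
      map_smul' := by
        intro c v
        rw [← map_smul]; congr 1; ext z; simp }
  have : T2Space (TangentSpace I x) := inferInstanceAs (T2Space E)
  refine ⟨LinearMap.toContinuousLinearMap A, fun X Z hX hZ => ?_⟩
  have h3 : flat g x (A (X x)) = (B (X x) : TangentSpace I x →ₗ[ℝ] ℝ) :=
    (flat g x).apply_symm_apply _
  have h4 := LinearMap.congr_fun h3 (Z x)
  exact h4.trans (TensorialAt.mkHom₂_apply h1 h2 hX hZ)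

variable (g) in
/-- `cov` is the Levi-Civita connection of `g`: it is torsion free and `g` is parallel. As in Mathlib,
`cov Y x v` is `(∇_v Y)(x)`. -/
structure IsLeviCivita (cov : CovariantDerivative I E (fun x : M => TangentSpace I x)) : Prop where
  torsion_free : ∀ (X Y : Π x : M, TangentSpace I x) (x : M), MDiffAt (T% X) x → MDiffAt (T% Y) x →
    cov Y x (X x) - cov X x (Y x) = mlieBracket I X Y x
  metric : ∀ (X Y : Π x : M, TangentSpace I x) (x : M) (v : TangentSpace I x),
    MDiffAt (T% X) x → MDiffAt (T% Y) x →
    d% (fun y => g.inner y (X y) (Y y)) x v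
      = g.inner x (cov X x v) (Y x) + g.inner x (X x) (cov Y x v)

open Classical in
variable (g) in
theorem exists_isLeviCivita :
    ∃ cov : CovariantDerivative I E (fun x : M => TangentSpace I x), IsLeviCivita g cov := by
  let c : (Π x : M, TangentSpace I x) → Π x : M, TangentSpace I x →L[ℝ] TangentSpace I x :=
    fun σ x => if h : MDiffAt (T% σ) x then (exists_koszul_cov g h).choose else 0
  have hc : ∀ (σ X Z : Π x : M, TangentSpace I x) (x : M), MDiffAt (T% σ) x → MDiffAt (T% X) x →
      MDiffAt (T% Z) x → g.inner x (c σ x (X x)) (Z x) = koszul g σ X Z x := by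
    intro σ X Z x hσ hX hZ
    simp only [c, dif_pos hσ]
    exact (exists_koszul_cov g hσ).choose_spec X Z hX hZ
  have hext : ∀ {x : M} (v : TangentSpace I x), MDiffAt (T% (FiberBundle.extend E v)) x :=
    fun v => FiberBundle.mdifferentiableAt_extend ..
  refine ⟨⟨c, ⟨?_, ?_⟩⟩, ⟨?_, ?_⟩⟩
  · intro σ σ' x hσ hσ' _
    ext v
    refine metric_ext (g := g) fun z => ?_
    have h := hc (σ + σ') (FiberBundle.extend E v) (FiberBundle.extend E z) x
      (mdifferentiableAt_add_section hσ hσ') (hext v) (hext z)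
    rw [koszul_add_mid hσ hσ' (hext v) (hext z), ← hc _ _ _ _ hσ (hext v) (hext z),
      ← hc _ _ _ _ hσ' (hext v) (hext z)] at h
    simpa using h
  · intro σ f x hσ hf _
    ext v
    refine metric_ext (g := g) fun z => ?_
    have h := hc (f • σ) (FiberBundle.extend E v) (FiberBundle.extend E z) x
      (hf.smul_section hσ) (hext v) (hext z)
    rw [koszul_smul_mid hσ (hext v) (hext z) hf, ← hc _ _ _ _ hσ (hext v) (hext z)] at h
    simpa using h
  · intro X Y x hX hY
    refine metric_ext (g := g) fun z => ?_
    have h1 := hc Y X (FiberBundle.extend E z) x hY hX (hext z)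
    have h2 := hc X Y (FiberBundle.extend E z) x hX hY (hext z)
    simp only [FiberBundle.extend_apply_self] at h1 h2
    simp only [map_sub, sub_apply, h1, h2, koszul]
    rw [mlieBracket_swap_apply (V := Y) (W := X),
      show (fun y => g.inner y (X y) (Y y)) = fun y => g.inner y (Y y) (X y) from
        funext fun y => g.symm y _ _]
    simp
    ring
  · intro X Y x v hX hY
    have h1 := hc X (FiberBundle.extend E v) Y x hX (hext v) hY
    have h2 := hc Y (FiberBundle.extend E v) X x hY (hext v) hX
    simp only [FiberBundle.extend_apply_self] at h1 h2
    rw [g.symm x (X x)]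
    simp only [h1, h2, koszul]
    rw [mlieBracket_swap_apply (V := Y) (W := X),
      show (fun y => g.inner y (X y) (Y y)) = fun y => g.inner y (Y y) (X y) from
        funext fun y => g.symm y _ _]
    simp
    ring

variable (g) in
/-- The Levi-Civita connection of `g`. -/
def leviCivita : CovariantDerivative I E (fun x : M => TangentSpace I x) :=
  (exists_isLeviCivita g).choose

theorem leviCivita_spec : IsLeviCivita g (leviCivita g) := (exists_isLeviCivita g).choose_spec

/-- A Levi-Civita connection is determined on differentiable fields by the Koszul formula. -/
theorem IsLeviCivita.koszul_eq {cov : CovariantDerivative I E (fun x : M => TangentSpace I x)}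
    (h : IsLeviCivita g cov) {σ X Z : Π x : M, TangentSpace I x} {x : M}
    (hσ : MDiffAt (T% σ) x) (hX : MDiffAt (T% X) x) (hZ : MDiffAt (T% Z) x) :
    g.inner x (cov σ x (X x)) (Z x) = koszul g σ X Z x := by
  have a1 := h.metric σ Z x (X x) hσ hZ
  have a2 := h.metric X Z x (σ x) hX hZ
  have a3 := h.metric X σ x (Z x) hX hσ
  rw [koszul, a1, a2, a3, ← h.torsion_free X σ x hX hσ, ← h.torsion_free X Z x hX hZ,
    ← h.torsion_free σ Z x hσ hZ]
  simp only [map_sub, sub_apply]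
  rw [g.symm x (σ x) (cov Z x (X x)), g.symm x (X x) (cov Z x (σ x)),
    g.symm x (X x) (cov σ x (Z x))]
  ring
end LC

/-! ### The pullback of a connection along a map -/

section Pull

variable {E : Type*} [NormedAddCommGroup E] [NormedSpace ℝ E]
  {H : Type*} [TopologicalSpace H] {I : ModelWithCorners ℝ E H}
  {M : Type*} [TopologicalSpace M] [ChartedSpace H M]
  {E' : Type*} [NormedAddCommGroup E'] [NormedSpace ℝ E'] [FiniteDimensional ℝ E']
  {H' : Type*} [TopologicalSpace H'] {I' : ModelWithCorners ℝ E' H'}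
  {N : Type*} [TopologicalSpace N] [ChartedSpace H' N] [IsManifold I' ∞ N]

variable (I') in
/-- The coordinates of tangent vectors at `y`, in the trivialization of the tangent bundle at `p`. -/
def coordAt (p y : N) : TangentSpace I' y →L[ℝ] E' :=
  (trivializationAt E' (fun y : N => TangentSpace I' y) p).continuousLinearMapAt ℝ y

variable (I') in
/-- The inverse of `coordAt I' p y`. For a fixed vector `e`, `y ↦ coordSymmAt I' p y e` is a local
field with constant coordinates near `p`. -/
def coordSymmAt (p y : N) : E' →L[ℝ] TangentSpace I' y :=
  (trivializationAt E' (fun y : N => TangentSpace I' y) p).symmL ℝ y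

variable (I) in
/-- The pullback connection `∇^F` on the sections `s` of `F^* TN` (vector fields along `F`).
Near `x`, write `s = ∑ s^i (e_i ∘ F)`, where `e_i` is the frame of `TN` given by the trivialization
at `F x`; then `∇^F_v s = ∑ ds^i(v) e_i + s^i ∇_{dF(v)} e_i`. The first summand below is
`∑ ds^i(v) e_i`, and the second is the derivative along `dF(v)` of the field `∑ s^i(x) e_i`. -/
def pullbackCov (cov : CovariantDerivative I' E' (fun y : N => TangentSpace I' y)) (F : M → N)
    (s : Π x : M, TangentSpace I' (F x)) (x : M) : TangentSpace I x →L[ℝ] TangentSpace I' (F x) :=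
  (coordSymmAt I' (F x) (F x)).comp (d% (fun y => coordAt I' (F x) (F y) (s y)) x) +
    (cov (fun z => coordSymmAt I' (F x) z (coordAt I' (F x) (F x) (s x))) (F x)).comp
      (mfderiv I I' F x)

theorem mem_base (p : N) :
    p ∈ (trivializationAt E' (fun y : N => TangentSpace I' y) p).baseSet :=
  FiberBundle.mem_baseSet_trivializationAt' p

theorem coordSymmAt_coordAt (p : N) (v : TangentSpace I' p) :
    coordSymmAt I' p p (coordAt I' p p v) = v :=
  Trivialization.symmL_continuousLinearMapAt _ (mem_base p) v

theorem coordAt_coordSymmAt (p : N) (e : E') : ∀ᶠ y in 𝓝 p,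
    coordAt I' p y (coordSymmAt I' p y e) = e := by
  filter_upwards [(trivializationAt E' (fun y : N => TangentSpace I' y) p).open_baseSet.mem_nhds
    (mem_base p)] with y hy
  exact Trivialization.continuousLinearMapAt_symmL _ hy e

theorem mdiffAt_coord {Y : Π y : N, TangentSpace I' y} {p : N} (hY : MDiffAt (T% Y) p) :
    MDiffAt (fun y => coordAt I' p y (Y y)) p := by
  rw [mdifferentiableAt_totalSpace] at hY
  refine hY.2.congr_of_eventuallyEq ?_
  filter_upwards [(trivializationAt E' (fun y : N => TangentSpace I' y) p).open_baseSet.mem_nhds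
    (mem_base p)] with y hy
  exact Trivialization.continuousLinearMapAt_apply_of_mem _ _ hy _

theorem mdiffAt_coordSymm (p : N) (e : E') :
    MDiffAt (T% (fun y => coordSymmAt I' p y e)) p := by
  have h := FiberBundle.mdifferentiableAt_extend I' E' (coordSymmAt I' p p e)
  refine h.congr_of_eventuallyEq ?_
  filter_upwards [(trivializationAt E' (fun y : N => TangentSpace I' y) p).open_baseSet.mem_nhds
    (mem_base p)] with y hy
  have h1 := (coordAt_coordSymmAt (I' := I') p e).self_of_nhds
  rw [coordAt, Trivialization.continuousLinearMapAt_apply_of_mem _ _ (mem_base p)] at h1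
  simp only [FiberBundle.extend, h1]
  congr 1
  exact (Trivialization.symmL_apply _ hy e)

theorem cov_eq_coord (cov : CovariantDerivative I' E' (fun y : N => TangentSpace I' y))
    {Y : Π y : N, TangentSpace I' y} {p : N} (hY : MDiffAt (T% Y) p) (w : TangentSpace I' p) :
    cov Y p w = coordSymmAt I' p p (d% (fun y => coordAt I' p y (Y y)) p w) +
      cov (fun z => coordSymmAt I' p z (coordAt I' p p (Y p))) p w := by
  have hT : TensorialAt I' E' (fun Y : Π y : N, TangentSpace I' y => cov Y p w -
      coordSymmAt I' p p (d% (fun y => coordAt I' p y (Y y)) p w)) p := by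
    constructor
    · intro f σ hf hσ
      have e : d% (fun y => coordAt I' p y ((f • σ) y)) p =
          f p • d% (fun y => coordAt I' p y (σ y)) p
          + (d% f p).smulRight (coordAt I' p p (σ p)) := by
        rw [← mvfderiv_fun_smul hf (mdiffAt_coord hσ)]; simp
      rw [e, cov.isCovariantDerivativeOnUniv.leibniz hσ hf]
      simp [coordSymmAt_coordAt, smul_sub]
    · intro σ σ' hσ hσ'
      have e : d% (fun y => coordAt I' p y ((σ + σ') y)) p =
          d% (fun y => coordAt I' p y (σ y)) p + d% (fun y => coordAt I' p y (σ' y)) p := by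
        rw [← mvfderiv_fun_add (mdiffAt_coord hσ) (mdiffAt_coord hσ')]; simp
      rw [e, cov.isCovariantDerivativeOnUniv.add hσ hσ']
      simp
      abel
  have h := hT.pointwise hY (mdiffAt_coordSymm p (coordAt I' p p (Y p)))
    (coordSymmAt_coordAt p (Y p)).symm
  have e : d% (fun y => coordAt I' p y (coordSymmAt I' p y (coordAt I' p p (Y p)))) p = 0 := by
    have h1 : (fun y => coordAt I' p y (coordSymmAt I' p y (coordAt I' p p (Y p)))) =ᶠ[𝓝 p]
        fun _ => coordAt I' p p (Y p) := coordAt_coordSymmAt p _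
    rw [mvfderiv, h1.mfderiv_eq, mfderiv_const]
    exact ContinuousLinearMap.comp_zero _
  simp only [e] at h
  rw [sub_eq_iff_eq_add] at h
  rw [h]; simp [add_comm]

/-- The defining property `∇^F_v (Y ∘ F) = ∇_{dF(v)} Y` of the pullback connection. -/
theorem pullbackCov_comp (cov : CovariantDerivative I' E' (fun y : N => TangentSpace I' y))
    {F : M → N} {x : M} (hF : MDifferentiableAt I I' F x) {Y : Π y : N, TangentSpace I' y}
    (hY : MDiffAt (T% Y) (F x)) (v : TangentSpace I x) :
    pullbackCov I cov F (fun y => Y (F y)) x v = cov Y (F x) (mfderiv I I' F x v) := by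
  rw [cov_eq_coord cov hY, pullbackCov]
  have h := mfderiv_comp_apply x (mdiffAt_coord hY) hF v
  simp only [add_apply, ContinuousLinearMap.comp_apply]
  congr 2

theorem mdiffAt_coord_along {F : M → N} {x : M} {s : Π x : M, TangentSpace I' (F x)}
    (hs : MDifferentiableAt I I'.tangent (fun y => (⟨F y, s y⟩ : TangentBundle I' N)) x) :
    MDiffAt (fun y => coordAt I' (F x) (F y) (s y)) x := by
  rw [mdifferentiableAt_totalSpace] at hs
  refine hs.2.congr_of_eventuallyEq ?_
  filter_upwards [hs.1.continuousAt.preimage_mem_nhds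
    ((trivializationAt E' (fun y : N => TangentSpace I' y) (F x)).open_baseSet.mem_nhds
    (mem_base (F x)))] with y hy
  exact Trivialization.continuousLinearMapAt_apply_of_mem _ _ hy _

/-- The pullback connection is additive. -/
theorem pullbackCov_add (cov : CovariantDerivative I' E' (fun y : N => TangentSpace I' y))
    {F : M → N} {x : M} {s s' : Π x : M, TangentSpace I' (F x)}
    (hs : MDifferentiableAt I I'.tangent (fun y => (⟨F y, s y⟩ : TangentBundle I' N)) x)
    (hs' : MDifferentiableAt I I'.tangent (fun y => (⟨F y, s' y⟩ : TangentBundle I' N)) x) :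
    pullbackCov I cov F (fun y => s y + s' y) x =
      pullbackCov I cov F s x + pullbackCov I cov F s' x := by
  have h := cov.isCovariantDerivativeOnUniv.add (mdiffAt_coordSymm (F x) (coordAt I' (F x) (F x) (s x)))
    (mdiffAt_coordSymm (F x) (coordAt I' (F x) (F x) (s' x)))
  have e : (fun z => coordSymmAt I' (F x) z (coordAt I' (F x) (F x) (s x + s' x))) =
    (fun z => coordSymmAt I' (F x) z (coordAt I' (F x) (F x) (s x))) +
    (fun z => coordSymmAt I' (F x) z (coordAt I' (F x) (F x) (s' x))) := by ext; simp
  rw [← e] at h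
  rw [pullbackCov, h]
  simp only [pullbackCov, map_add,
    mvfderiv_fun_add (mdiffAt_coord_along hs) (mdiffAt_coord_along hs')]
  ext v
  simp
  abel

/-- The pullback connection satisfies the Leibniz rule. -/
theorem pullbackCov_smul (cov : CovariantDerivative I' E' (fun y : N => TangentSpace I' y))
    {F : M → N} {x : M} {f : M → ℝ} {s : Π x : M, TangentSpace I' (F x)} (hf : MDiffAt f x)
    (hs : MDifferentiableAt I I'.tangent (fun y => (⟨F y, s y⟩ : TangentBundle I' N)) x) :
    pullbackCov I cov F (fun y => f y • s y) x =
      f x • pullbackCov I cov F s x + (d% f x).smulRight (s x) := by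
  have h := cov.isCovariantDerivativeOnUniv.smul_const (f x)
    (mdiffAt_coordSymm (F x) (coordAt I' (F x) (F x) (s x)))
  have e : (fun z => coordSymmAt I' (F x) z (coordAt I' (F x) (F x) (f x • s x))) =
    f x • (fun z => coordSymmAt I' (F x) z (coordAt I' (F x) (F x) (s x))) := by ext; simp
  rw [← e] at h
  rw [pullbackCov, h]
  simp only [pullbackCov, map_smul, mvfderiv_fun_smul hf (mdiffAt_coord_along hs)]
  ext v
  simp [coordSymmAt_coordAt]
  abel
end Pull

/-! ### Vector fields, endomorphism fields and angles -/

section Sub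

variable {E : Type*} [NormedAddCommGroup E] [NormedSpace ℝ E] [FiniteDimensional ℝ E]
  {H : Type*} [TopologicalSpace H] {I : ModelWithCorners ℝ E H}
  {M : Type*} [TopologicalSpace M] [ChartedSpace H M] [IsManifold I ∞ M]
variable (g : ContMDiffRiemannianMetric I ∞ E (fun x : M => TangentSpace I x))

/-- The `g`-orthogonal complement of a subspace of the tangent space at `x`. -/
def perp (x : M) (K : Submodule ℝ (TangentSpace I x)) : Submodule ℝ (TangentSpace I x) where
  carrier := {v | ∀ w ∈ K, g.inner x w v = 0}
  add_mem' := by intro v v' hv hv' w hw; simp [hv w hw, hv' w hw]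
  zero_mem' := by intro w _; simp
  smul_mem' := by intro c v hv w hw; simp [hv w hw]

theorem isCompl_perp (x : M) (K : Submodule ℝ (TangentSpace I x)) : IsCompl K (perp g x K) := by
  let B : LinearMap.BilinForm ℝ (TangentSpace I x) :=
    LinearMap.mk₂ ℝ (fun v w => g.inner x v w) (by simp) (by simp) (by simp) (by simp)
  have hB : B.IsRefl := fun v w h => by simpa [B, g.symm x w v] using h
  have h : B.orthogonal K = perp g x K := by
    ext v; rfl
  rw [← h, LinearMap.BilinForm.isCompl_orthogonal_iff_disjoint hB, h, Submodule.disjoint_def]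
  intro v hv hv'
  by_contra hne
  exact (g.pos x v hne).ne' (hv' v hv)

/-- The angle between a vector and a subspace: the infimum of the angles to its nonzero elements. -/
def angleToSubspace (x : M) (v : TangentSpace I x) (K : Submodule ℝ (TangentSpace I x)) : ℝ :=
  ⨅ w : {w : TangentSpace I x // w ∈ K ∧ w ≠ 0},
    Real.arccos (g.inner x v w / (√(g.inner x v v) * √(g.inner x w.1 w.1)))

/-- A vector field is smooth. -/
def IsSmoothField (X : Π x : M, TangentSpace I x) : Prop :=
  ContMDiff I I.tangent ∞ (fun x => (⟨x, X x⟩ : TangentBundle I M))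

/-- A field of endomorphisms of the tangent spaces is smooth, as a section of `End(TM)`. -/
def IsSmoothEnd (R : Π x : M, TangentSpace I x →L[ℝ] TangentSpace I x) : Prop :=
  ContMDiff I (I.prod 𝓘(ℝ, E →L[ℝ] E)) ∞
    (fun x => TotalSpace.mk' (E →L[ℝ] E)
      (E := fun x : M => TangentSpace I x →L[ℝ] TangentSpace I x) x (R x))

/-- `R` is parallel for the Levi-Civita connection: `∇_v (R Y) = R (∇_v Y)`. -/
def IsParallelEnd (R : Π x : M, TangentSpace I x →L[ℝ] TangentSpace I x) : Prop :=
  ∀ Y : Π x : M, TangentSpace I x, IsSmoothField Y → ∀ (x : M) (v : TangentSpace I x),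
    leviCivita g (fun y => R y (Y y)) x v = R x (leviCivita g Y x v)

/-- `(J₁, J₂, J₃, g)` is a hyperkähler structure on `M`. -/
structure IsHyperkahler (J₁ J₂ J₃ : Π x : M, TangentSpace I x →L[ℝ] TangentSpace I x) : Prop where
  smooth : ∀ R ∈ ({J₁, J₂, J₃} : Set (Π x : M, TangentSpace I x →L[ℝ] TangentSpace I x)),
    IsSmoothEnd R
  sq_eq_neg : ∀ R ∈ ({J₁, J₂, J₃} : Set (Π x : M, TangentSpace I x →L[ℝ] TangentSpace I x)),
    ∀ (x : M) (v : TangentSpace I x), R x (R x v) = -v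
  mul_eq : ∀ (x : M) (v : TangentSpace I x), J₁ x (J₂ x v) = J₃ x v
  mul_eq_neg : ∀ (x : M) (v : TangentSpace I x), J₂ x (J₁ x v) = -J₃ x v
  isometry : ∀ R ∈ ({J₁, J₂, J₃} : Set (Π x : M, TangentSpace I x →L[ℝ] TangentSpace I x)),
    ∀ (x : M) (v w : TangentSpace I x), g.inner x (R x v) (R x w) = g.inner x v w
  parallel : ∀ R ∈ ({J₁, J₂, J₃} : Set (Π x : M, TangentSpace I x →L[ℝ] TangentSpace I x)),
    IsParallelEnd g R

end Sub

/-! ### Submersions -/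

section Subm

variable {E : Type*} [NormedAddCommGroup E] [NormedSpace ℝ E] [FiniteDimensional ℝ E]
  {H : Type*} [TopologicalSpace H] {I : ModelWithCorners ℝ E H}
  {M : Type*} [TopologicalSpace M] [ChartedSpace H M] [IsManifold I ∞ M]
  {E' : Type*} [NormedAddCommGroup E'] [NormedSpace ℝ E'] [FiniteDimensional ℝ E']
  {H' : Type*} [TopologicalSpace H'] {I' : ModelWithCorners ℝ E' H'}
  {N : Type*} [TopologicalSpace N] [ChartedSpace H' N] [IsManifold I' ∞ N]
  (g : ContMDiffRiemannianMetric I ∞ E (fun x : M => TangentSpace I x))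
  (g' : ContMDiffRiemannianMetric I' ∞ E' (fun y : N => TangentSpace I' y))
  (F : M → N) (R : Π x : M, TangentSpace I x →L[ℝ] TangentSpace I x)

variable (I I') in
/-- The vertical space at `x`: the kernel of the differential of `F`. -/
def vert (x : M) : Submodule ℝ (TangentSpace I x) :=
  LinearMap.ker (mfderiv I I' F x : TangentSpace I x →ₗ[ℝ] TangentSpace I' (F x))

variable (I') in
/-- The horizontal space at `x`: the orthogonal complement of the vertical space. -/
def horiz (x : M) : Submodule ℝ (TangentSpace I x) := perp g x (vert I I' F x)

variable (I') in
/-- The orthogonal projection onto the vertical space. -/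
def vproj (x : M) : TangentSpace I x →ₗ[ℝ] TangentSpace I x :=
  (vert I I' F x).projection (horiz I' g F x) (isCompl_perp g x _)

variable (I') in
/-- The orthogonal projection onto the horizontal space. -/
def hproj (x : M) : TangentSpace I x →ₗ[ℝ] TangentSpace I x :=
  (horiz I' g F x).projection (vert I I' F x) (isCompl_perp g x _).symm

/-- The second fundamental form `(∇F_*)(X, Y) = ∇^F_X (F_* Y) - F_* (∇_X Y)` of `F`. -/
def secondFundamentalForm (X Y : Π x : M, TangentSpace I x) (x : M) : TangentSpace I' (F x) :=
  pullbackCov I (leviCivita g') F (fun y => mfderiv I I' F y (Y y)) x (X x) -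
    mfderiv I I' F x (leviCivita g Y x (X x))

/-- `F` is a totally geodesic map: its second fundamental form vanishes. -/
def IsTotallyGeodesic : Prop :=
  ∀ X Y : Π x : M, TangentSpace I x, IsSmoothField X → IsSmoothField Y →
    ∀ x, secondFundamentalForm g g' F X Y x = 0

/-- `F` is a horizontally conformal submersion with dilation `lam`. -/
structure IsHorizontallyConformalSubmersion (lam : M → ℝ) : Prop where
  smooth : ContMDiff I I' ∞ F
  surjective : ∀ x, Function.Surjective (mfderiv I I' F x)
  dilation_pos : ∀ x, 0 < lam x
  conformal : ∀ x, ∀ X ∈ horiz I' g F x, ∀ Y ∈ horiz I' g F x,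
    g'.inner (F x) (mfderiv I I' F x X) (mfderiv I I' F x Y) = lam x ^ 2 * g.inner x X Y

variable (I') in
/-- `F`, with dilation `lam`, is horizontally homothetic: the gradient of `lam` is vertical, i.e.
the derivative of `lam` in every horizontal direction is zero. -/
def IsHorizontallyHomothetic (lam : M → ℝ) : Prop :=
  ∀ x, ∀ X ∈ horiz I' g F x, d% lam x X = 0

variable (I') in
/-- `(J₁, J₂, J₃)` is an almost h-conformal slant basis around every point: each point has a
neighbourhood `U` such that, for each `R ∈ {J₁, J₂, J₃}`, the angle between `R V` and `ker F_*` is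
the same number `θ` for all nonzero `V ∈ ker (F_*)_q` and all `q ∈ U`. -/
def IsAlmostSlantBasis (J₁ J₂ J₃ : Π x : M, TangentSpace I x →L[ℝ] TangentSpace I x) : Prop :=
  ∀ p : M, ∃ U : Set M, IsOpen U ∧ p ∈ U ∧
    ∀ R ∈ ({J₁, J₂, J₃} : Set (Π x : M, TangentSpace I x →L[ℝ] TangentSpace I x)),
      ∃ θ : ℝ, ∀ q ∈ U, ∀ V ∈ vert I I' F q, V ≠ 0 →
        angleToSubspace g q (R q V) (vert I I' F q) = θ

variable (I') in
/-- A vector field with values in `ker F_*`. -/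
def IsVertical (V : Π x : M, TangentSpace I x) : Prop := ∀ x, V x ∈ vert I I' F x

variable (I') in
/-- A vector field with values in `(ker F_*)^⊥`. -/
def IsHorizontal (X : Π x : M, TangentSpace I x) : Prop := ∀ x, X x ∈ horiz I' g F x

variable (I') in
/-- `φ_R V` is the vertical part of `R V`, for `V` vertical; extended by `0` to horizontal vectors. -/
def phi (x : M) : TangentSpace I x →ₗ[ℝ] TangentSpace I x :=
  vproj I' g F x ∘ₗ (R x : TangentSpace I x →ₗ[ℝ] TangentSpace I x) ∘ₗ vproj I' g F x

variable (I') in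
/-- `ω_R V` is the horizontal part of `R V`, for `V` vertical; extended by `0` to horizontal
vectors. -/
def omega (x : M) : TangentSpace I x →ₗ[ℝ] TangentSpace I x :=
  hproj I' g F x ∘ₗ (R x : TangentSpace I x →ₗ[ℝ] TangentSpace I x) ∘ₗ vproj I' g F x

variable (I') in
/-- `C_R X` is the horizontal part of `R X`, for `X` horizontal; extended by `0` to vertical
vectors. -/
def capC (x : M) : TangentSpace I x →ₗ[ℝ] TangentSpace I x :=
  hproj I' g F x ∘ₗ (R x : TangentSpace I x →ₗ[ℝ] TangentSpace I x) ∘ₗ hproj I' g F x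

variable (I') in
/-- The tensor `T_X Y = H ∇_{V X} (V Y) + V ∇_{V X} (H Y)`, where `V` and `H` are the vertical and
horizontal projections. -/
def tensorT (X Y : Π x : M, TangentSpace I x) (x : M) : TangentSpace I x :=
  hproj I' g F x (leviCivita g (fun y => vproj I' g F y (Y y)) x (vproj I' g F x (X x))) +
    vproj I' g F x (leviCivita g (fun y => hproj I' g F y (Y y)) x (vproj I' g F x (X x)))

variable (I') in
/-- The tensor `A_X Y = H ∇_{H X} (V Y) + V ∇_{H X} (H Y)`. -/
def tensorA (X Y : Π x : M, TangentSpace I x) (x : M) : TangentSpace I x :=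
  hproj I' g F x (leviCivita g (fun y => vproj I' g F y (Y y)) x (hproj I' g F x (X x))) +
    vproj I' g F x (leviCivita g (fun y => hproj I' g F y (Y y)) x (hproj I' g F x (X x)))

variable (I') in
/-- `V ∇_X Y`; for vertical `X` and `Y` this is the connection `∇^` (nabla hat) on the fibres. -/
def vNabla (X Y : Π x : M, TangentSpace I x) (x : M) : TangentSpace I x :=
  vproj I' g F x (leviCivita g Y x (X x))

variable (I') in
/-- `H ∇_X Y`. -/
def hNabla (X Y : Π x : M, TangentSpace I x) (x : M) : TangentSpace I x :=
  hproj I' g F x (leviCivita g Y x (X x))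

variable (I') in
/-- `C_R (T_V φ_R W + H ∇_V ω_R W) + ω_R (∇^_V φ_R W + T_V ω_R W) = 0` for all vertical fields
`V`, `W`. -/
def VerticalCondition : Prop :=
  ∀ V W : Π x : M, TangentSpace I x, IsSmoothField V → IsSmoothField W →
    IsVertical I' F V → IsVertical I' F W → ∀ x,
      capC I' g F R x (tensorT I' g F V (fun y => phi I' g F R y (W y)) x +
          hNabla I' g F V (fun y => omega I' g F R y (W y)) x) +
        omega I' g F R x (vNabla I' g F V (fun y => phi I' g F R y (W y)) x +
          tensorT I' g F V (fun y => omega I' g F R y (W y)) x) = 0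

variable (I') in
/-- `C_R (A_X φ_R V + H ∇_X ω_R V) + ω_R (V ∇_X φ_R V + A_X ω_R V) = 0` for all vertical fields `V`
and horizontal fields `X`. -/
def MixedCondition : Prop :=
  ∀ V X : Π x : M, TangentSpace I x, IsSmoothField V → IsSmoothField X →
    IsVertical I' F V → IsHorizontal I' g F X → ∀ x,
      capC I' g F R x (tensorA I' g F X (fun y => phi I' g F R y (V y)) x +
          hNabla I' g F X (fun y => omega I' g F R y (V y)) x) +
        omega I' g F R x (vNabla I' g F X (fun y => phi I' g F R y (V y)) x +
          tensorA I' g F X (fun y => omega I' g F R y (V y)) x) = 0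

end Subm

end HSlant

end

open HSlant

/-! Both sides of each equivalence are compared with one geometric statement: the vertical
distribution is parallel (`IsVerticalParallel`) and `lam` is constant to first order in horizontal
directions.

Write B for the second fundamental form of `F`. It is symmetric, because the pullback connection and
the Levi-Civita connection of the source are both torsion-free (`pullbackCov_torsion`,
`secondFundamentalForm_symm`). If `W` is vertical, then `F_* W = 0` and B(X, W) = -F_*(∇_X W), so B
vanishes on vertical second arguments exactly when covariant derivatives of vertical fields stay
vertical. By symmetry this also settles vertical first arguments.

For horizontal Y and Z, differentiate g'(F_* Y, F_* Z) = lam² g(Y, Z) along X. Since both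
connections are metric, g'(B(X, Y), F_* Z) + g'(F_* Y, B(X, Z)) = 2 lam (X lam) g(Y, Z). If B = 0,
taking X = Y = Z forces X lam = 0. Conversely, if `lam` has no horizontal derivative, the trilinear
form g'(B(X, Y), F_* Z) on horizontal fields is symmetric in X, Y and skew in Y, Z, hence zero: the
argument that makes the Levi-Civita connection unique. This gives `isTotallyGeodesic_iff`.

It remains to decode conditions (i) and (iii). For vertical W, `R W = φ_R W + ω_R W`, and the two
bracketed sums in the condition are the horizontal and vertical parts of ∇_X(R W) = R ∇_X W.
Applying `C_R` to the first and `ω_R` to the second yields the horizontal part of R(R ∇_X W) = -∇_X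
W. So (i) and (iii) say that ∇_X W is vertical for X vertical and for X horizontal respectively
(`isVerticalParallel_iff`). The argument treats one structure `R` at a time and applies equally to
I, J and K.

Regularity is the remaining point: neither `lam` nor the projections are assumed smooth. Both are
recovered from the smooth pullback form g'(F_* ·, F_* ·). -/

noncomputable section

namespace HSlant

/-! ### Brackets as commutators of derivations -/

section Calculus

variable {E : Type*} [NormedAddCommGroup E] [NormedSpace ℝ E] [FiniteDimensional ℝ E]
  {H : Type*} [TopologicalSpace H] {I : ModelWithCorners ℝ E H}
  {M : Type*} [TopologicalSpace M] [ChartedSpace H M]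

/-- A family of linear maps on a finite-dimensional space is smooth if it is smooth on each vector. -/
theorem contMDiffAt_clm_of_apply {F : Type*} [NormedAddCommGroup F] [NormedSpace ℝ F]
    {G : Type*} [NormedAddCommGroup G] [NormedSpace ℝ G] [FiniteDimensional ℝ G] {n : ℕ∞ω}
    {A : M → G →L[ℝ] F} {x : M}
    (hA : ∀ e, ContMDiffAt I 𝓘(ℝ, F) n (fun y => A y e) x) :
    ContMDiffAt I 𝓘(ℝ, G →L[ℝ] F) n A x := by
  let b := Module.finBasis ℝ G
  have h : A = fun y => ∑ i, ContinuousLinearMap.smulRightL ℝ G F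
      (LinearMap.toContinuousLinearMap (b.coord i)) (A y (b i)) := by
    funext y
    ext e
    conv_lhs => rw [← b.sum_repr e, map_sum]
    simp
  rw [h]
  refine contMDiffAt_finsetSum fun i _ => ?_
  exact ((ContinuousLinearMap.smulRightL ℝ G F
      (LinearMap.toContinuousLinearMap (b.coord i))).contMDiff.contMDiffAt).comp x (hA (b i))

/-- The derivative of a vector-valued function along `[X, Y]` is the commutator of the derivatives
along `X` and `Y`. -/
theorem mvfderiv_mlieBracket [IsManifold I ∞ M] [I.Boundaryless] {F : Type*}
    [NormedAddCommGroup F] [NormedSpace ℝ F] {f : M → F} {x : M} {X Y : Π x : M, TangentSpace I x}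
    (hf : ContMDiffAt I 𝓘(ℝ, F) 2 f x) (hX : MDiffAt (T% X) x) (hY : MDiffAt (T% Y) x) :
    d% f x (mlieBracket I X Y x) =
      d% (fun y => d% f y (Y y)) x (X x) - d% (fun y => d% f y (X y)) x (Y x) := by
  set φ := extChartAt I x with hφ
  -- `p X` is the field X read in the chart at x; the claim is transported to the model space, where
  -- it is the symmetry of the second derivative.
  let p : (Π x : M, TangentSpace I x) → E → E := fun X => mpullback 𝓘(ℝ, E) I φ.symm X
  have hp : ∀ X : Π x : M, TangentSpace I x, MDiffAt (T% X) x → DifferentiableAt ℝ (p X) (φ x) := by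
    intro X hX
    have := (mdifferentiableWithinAt_univ.2 hX).differentiableWithinAt_mpullbackWithin_vectorField
    rw [preimage_univ, univ_inter, I.range_eq_univ, mpullbackWithin_univ] at this
    exact differentiableWithinAt_univ.1 this
  have hfφ : ContDiffAt ℝ 2 (f ∘ φ.symm) (φ x) := by
    have := hf.2
    have hu : (extChartAt I x).symm ⁻¹' univ ∩ range I = univ := by rw [I.range_eq_univ]; simp
    exact contDiffWithinAt_univ.1 (hu ▸ this)
  have key := fderiv_apply_lieBracket (n := 2) hfφ (by simp) (hp Y hY) (hp X hX)
  have hch : ∀ (h : M → F) (z : M) (v : TangentSpace I z), z ∈ φ.source → MDiffAt h z →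
      d% h z v = fderiv ℝ (h ∘ φ.symm) (φ z) (mfderiv I 𝓘(ℝ, E) φ z v) := by
    intro h z v hz hh
    have e1 : (h ∘ φ.symm) ∘ φ =ᶠ[𝓝 z] h := by
      filter_upwards [(isOpen_extChartAt_source x).mem_nhds hz] with y hy
      simp [φ.left_inv hy]
    have h2 : MDifferentiableAt 𝓘(ℝ, E) I φ.symm (φ z) :=
      ((contMDiffOn_extChartAt_symm x).contMDiffAt
        ((isOpen_extChartAt_target x).mem_nhds (φ.map_source hz))).mdifferentiableAt (n := ∞) (by simp)
    have h3 : MDiffAt (h ∘ φ.symm) (φ z) :=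
      MDifferentiableAt.comp_of_eq (φ z) hh h2 (φ.left_inv hz)
    have h4 : MDifferentiableAt I 𝓘(ℝ, E) φ z := mdifferentiableAt_extChartAt (by simpa [hφ] using hz)
    have h5 := mfderiv_comp_apply z h3 h4 v
    rw [e1.mfderiv_eq, mfderiv_eq_fderiv] at h5
    exact h5
  have hpX : ∀ (X : Π x : M, TangentSpace I x), ∀ e ∈ φ.target,
      p X e = mfderiv I 𝓘(ℝ, E) φ (φ.symm e) (X (φ.symm e)) := by
    intro X e he
    have h1 := mfderiv_extChartAt_comp_mfderivWithin_extChartAt_symm he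
    have h2 := mfderivWithin_extChartAt_symm_comp_mfderiv_extChartAt he
    rw [I.range_eq_univ, mfderivWithin_univ] at h1 h2
    have h3 := ContinuousLinearMap.inverse_eq h2 h1
    change (mfderiv 𝓘(ℝ, E) I φ.symm e).inverse (X (φ.symm e)) = _
    rw [h3]
    rfl
  have hpx : ∀ X : Π x : M, TangentSpace I x, mfderiv I 𝓘(ℝ, E) φ x (X x) = p X (φ x) := by
    intro X
    rw [hpX X _ (mem_extChartAt_target x)]
    -- The base point occurs in the type of X z, so the equality of points is substituted through a
    -- free variable z.
    have : ∀ z, z = x → mfderiv I 𝓘(ℝ, E) φ x (X x) = (mfderiv I 𝓘(ℝ, E) φ z (X z) : E) := by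
      rintro _ rfl; rfl
    exact this _ (extChartAt_to_inv x)
  have hT : φ.target ∈ 𝓝 (φ x) := extChartAt_target_mem_nhds x
  -- This must hold on a neighbourhood, not just at φ x, because both sides are differentiated
  -- again.
  have hd : ∀ X : Π x : M, TangentSpace I x, (fun y => d% f y (X y)) ∘ φ.symm =ᶠ[𝓝 (φ x)]
      fun e => fderiv ℝ (f ∘ φ.symm) e (p X e) := by
    intro X
    have h1 : ∀ᶠ z in 𝓝 x, MDiffAt f z :=
      ((contMDiffAt_iff_contMDiffAt_nhds (by simp)).1 hf).mono fun z hz => hz.mdifferentiableAt (by simp)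
    have h2 := (continuousAt_extChartAt_symm (I := I) x).tendsto
    rw [extChartAt_to_inv] at h2
    filter_upwards [hT, h2.eventually h1] with e he hfe
    rw [hpX X e he, Function.comp_apply, hch f _ _ (φ.map_target he) hfe, φ.right_inv he]
  have hdd : ∀ X : Π x : M, TangentSpace I x, MDiffAt (T% X) x →
      MDiffAt (fun y => d% f y (X y)) x := by
    intro X hX
    have h1 : DifferentiableAt ℝ (fun e => fderiv ℝ (f ∘ φ.symm) e (p X e)) (φ x) :=
      ((hfφ.fderiv_right (m := 1) (by norm_num)).differentiableAt (by simp)).clm_apply (hp X hX)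
    have h2 := (h1.congr_of_eventuallyEq (hd X)).mdifferentiableAt
    have h4 : MDifferentiableAt I 𝓘(ℝ, E) φ x := mdifferentiableAt_extChartAt (by simp)
    refine (h2.comp x h4).congr_of_eventuallyEq ?_
    filter_upwards [extChartAt_source_mem_nhds (I := I) x] with y hy
    have : ∀ z, z = y → d% f y (X y) = d% f z (X z) := by
      rintro _ rfl; rfl
    exact this _ (φ.left_inv hy)
  have hb : mfderiv I 𝓘(ℝ, E) φ x (mlieBracket I X Y x) = lieBracket ℝ (p X) (p Y) (φ x) := by
    rw [mlieBracket, mlieBracketWithin, preimage_univ, univ_inter, I.range_eq_univ,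
      mpullbackWithin_univ, mpullbackWithin_univ]
    let w : E := lieBracketWithin ℝ (p X) (p Y) univ (φ x)
    change mfderiv I 𝓘(ℝ, E) φ x ((mfderiv I 𝓘(ℝ, E) φ x).inverse w) = _
    have h1 : w = lieBracket ℝ (p X) (p Y) (φ x) := by
      simp only [w, lieBracketWithin_univ]
    have h2 := isInvertible_mfderiv_extChartAt (I := I) (mem_extChartAt_source (I := I) x)
    rw [← h1]
    exact congrFun (congrArg DFunLike.coe h2.self_comp_inverse) _
  have hs := mem_extChartAt_source (I := I) x
  rw [hch f x _ hs (hf.mdifferentiableAt (by simp)), hch _ x _ hs (hdd X hX),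
    hch _ x _ hs (hdd Y hY), hb, key, (hd X).fderiv_eq, (hd Y).fderiv_eq, hpx, hpx]

end Calculus

/-! ### The pullback connection is metric and torsion-free -/

section PullbackConnection

variable {E : Type*} [NormedAddCommGroup E] [NormedSpace ℝ E] [FiniteDimensional ℝ E]
  {H : Type*} [TopologicalSpace H] {I : ModelWithCorners ℝ E H}
  {M : Type*} [TopologicalSpace M] [ChartedSpace H M]
  {E' : Type*} [NormedAddCommGroup E'] [NormedSpace ℝ E'] [FiniteDimensional ℝ E']
  {H' : Type*} [TopologicalSpace H'] {I' : ModelWithCorners ℝ E' H'}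
  {N : Type*} [TopologicalSpace N] [ChartedSpace H' N] [IsManifold I' ∞ N]

theorem mvfderiv_congr {F : Type*} [NormedAddCommGroup F] [NormedSpace ℝ F] {f f' : M → F} {x : M}
    (h : f =ᶠ[𝓝 x] f') : d% f x = d% f' x := by
  ext v
  exact DFunLike.congr_fun (h.mfderiv_eq (I := I) (I' := 𝓘(ℝ, F))) v

/-- The product rule for a varying linear map applied to a varying vector. -/
theorem mvfderiv_clm_apply {G F : Type*} [NormedAddCommGroup G] [NormedSpace ℝ G]
    [NormedAddCommGroup F] [NormedSpace ℝ F] {A : M → G →L[ℝ] F} {a : M → G} {x : M}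
    (hA : MDiffAt A x) (ha : MDiffAt a x) (v : TangentSpace I x) :
    d% (fun y => A y (a y)) x v = d% A x v (a x) + A x (d% a x v) := by
  have h1 : HasFDerivAt (fun q : (G →L[ℝ] F) × G => q.1 q.2) _ (A x, a x) :=
    hasFDerivAt_fst.clm_apply hasFDerivAt_snd
  have h2 : HasMFDerivAt I 𝓘(ℝ, (G →L[ℝ] F) × G) (fun y => (A y, a y)) x
      ((d% A x).prod (d% a x)) :=
    ⟨hA.continuousAt.prodMk ha.continuousAt, hA.hasMFDerivAt.2.prodMk ha.hasMFDerivAt.2⟩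
  have h3 := (HasMFDerivAt.comp x h1.hasMFDerivAt h2).mfderiv
  refine Eq.trans (DFunLike.congr_fun h3 v) ?_
  exact add_comm (A x (d% a x v)) (d% A x v (a x))

/-- The product rule for a varying bilinear form applied to varying vectors. -/
theorem mvfderiv_clm_apply₂ {G : Type*} [NormedAddCommGroup G] [NormedSpace ℝ G]
    {A : M → G →L[ℝ] G →L[ℝ] ℝ} {a b : M → G} {x : M} (hA : MDiffAt A x) (ha : MDiffAt a x)
    (hb : MDiffAt b x) (v : TangentSpace I x) :
    d% (fun y => A y (a y) (b y)) x v = d% (fun y => A y (a x) (b x)) x v +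
      A x (d% a x v) (b x) + A x (a x) (d% b x v) := by
  have key : ∀ {a b : M → G}, MDiffAt a x → MDiffAt b x → d% (fun y => A y (a y) (b y)) x v =
      d% A x v (a x) (b x) + A x (d% a x v) (b x) + A x (a x) (d% b x v) := by
    intro a b ha hb
    have h : MDiffAt (fun y => A y (a y)) x := hA.clm_apply ha
    -- The full Leibniz rule; below it is also applied to constant vectors, which identifies the
    -- term d A(v)(a)(b) with the derivative of A on frozen arguments.
    rw [mvfderiv_clm_apply h hb, mvfderiv_clm_apply hA ha]
    simp
  have h := key (a := fun _ => a x) (b := fun _ => b x) mdifferentiableAt_const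
    mdifferentiableAt_const
  rw [key ha hb, h, mvfderiv_const, mvfderiv_const]
  simp

theorem coordAt_eq_mfderiv {p z : N} (hz : z ∈ (chartAt H' p).source) :
    coordAt I' p z = mfderiv I' 𝓘(ℝ, E') (extChartAt I' p) z :=
  TangentBundle.continuousLinearMapAt_trivializationAt hz

theorem contMDiffAt_coordSymm (p : N) (e : E') :
    ContMDiffAt I' I'.tangent ∞ (T% (fun y => coordSymmAt I' p y e)) p := by
  have h := FiberBundle.contMDiffAt_extend (k := ∞) I' E' (coordSymmAt I' p p e)
  refine h.congr_of_eventuallyEq ?_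
  filter_upwards [(trivializationAt E' (fun y : N => TangentSpace I' y) p).open_baseSet.mem_nhds
    (mem_base p)] with y hy
  have h1 := (coordAt_coordSymmAt (I' := I') p e).self_of_nhds
  rw [coordAt, Trivialization.continuousLinearMapAt_apply_of_mem _ _ (mem_base p)] at h1
  simp only [FiberBundle.extend, h1]
  congr 1
  exact (Trivialization.symmL_apply _ hy e)

theorem coordSymmAt_coordAt_of_mem {p y : N}
    (hy : y ∈ (trivializationAt E' (fun y : N => TangentSpace I' y) p).baseSet)
    (v : TangentSpace I' y) : coordSymmAt I' p y (coordAt I' p y v) = v :=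
  Trivialization.symmL_continuousLinearMapAt _ hy v

variable {g' : ContMDiffRiemannianMetric I' ∞ E' (fun y : N => TangentSpace I' y)}

/-- The inner product of smooth fields along a map is smooth. -/
theorem contMDiffAt_inner {F : M → N} {n : ℕ∞ω} (hn : n ≤ ∞)
    {s s' : Π x : M, TangentSpace I' (F x)} {x : M}
    (hs : ContMDiffAt I I'.tangent n (fun y => (⟨F y, s y⟩ : TangentBundle I' N)) x)
    (hs' : ContMDiffAt I I'.tangent n (fun y => (⟨F y, s' y⟩ : TangentBundle I' N)) x) :
    ContMDiffAt I 𝓘(ℝ) n (fun y => g'.inner (F y) (s y) (s' y)) x := by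
  have hF : ContMDiffAt I I' n F x := (contMDiffAt_totalSpace.1 hs).1
  have hg := ((g'.contMDiff.of_le hn) (F x)).comp x hF
  have h : ContMDiffAt I (I'.prod 𝓘(ℝ)) n
      (fun m ↦ TotalSpace.mk' ℝ (E := Bundle.Trivial N ℝ) (F m) (g'.inner (F m) (s m) (s' m))) x := by
    apply ContMDiffAt.clm_bundle_apply₂ (F₁ := E') (F₂ := E')
    · exact hg
    · exact hs
    · exact hs'
  exact (contMDiffAt_totalSpace.1 h).2

variable (g') in
/-- The metric in the trivialization of the tangent bundle at `p`. -/
def gram (p z : N) : E' →L[ℝ] E' →L[ℝ] ℝ :=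
  (ContinuousLinearMap.precomp ℝ (coordSymmAt I' p z)).comp ((g'.inner z).comp (coordSymmAt I' p z))

@[simp]
theorem gram_apply (p z : N) (a b : E') :
    gram g' p z a b = g'.inner z (coordSymmAt I' p z a) (coordSymmAt I' p z b) := rfl

/-- In finite dimension it suffices to check matrix entries, which are inner products of smooth
local frame fields. -/
theorem contMDiffAt_gram (p : N) :
    ContMDiffAt I' 𝓘(ℝ, E' →L[ℝ] E' →L[ℝ] ℝ) ∞ (gram g' p) p := by
  refine contMDiffAt_clm_of_apply fun a => contMDiffAt_clm_of_apply fun b => ?_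
  exact contMDiffAt_inner (F := id) le_rfl (contMDiffAt_coordSymm p a) (contMDiffAt_coordSymm p b)

/-- The pullback of a metric connection is metric. -/
theorem pullbackCov_inner {cov : CovariantDerivative I' E' (fun y : N => TangentSpace I' y)}
    (hcov : IsLeviCivita g' cov) {F : M → N} {x : M} {s s' : Π x : M, TangentSpace I' (F x)}
    (hs : MDifferentiableAt I I'.tangent (fun y => (⟨F y, s y⟩ : TangentBundle I' N)) x)
    (hs' : MDifferentiableAt I I'.tangent (fun y => (⟨F y, s' y⟩ : TangentBundle I' N)) x)
    (v : TangentSpace I x) :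
    d% (fun y => g'.inner (F y) (s y) (s' y)) x v =
      g'.inner (F x) (pullbackCov I cov F s x v) (s' x) +
        g'.inner (F x) (s x) (pullbackCov I cov F s' x v) := by
  have hF : MDifferentiableAt I I' F x := ((mdifferentiableAt_totalSpace _ _).1 hs).1
  have hG : MDifferentiableAt I' 𝓘(ℝ, E' →L[ℝ] E' →L[ℝ] ℝ) (gram g' (F x)) (F x) :=
    (contMDiffAt_gram (F x)).mdifferentiableAt (by simp)
  have hA : MDiffAt (fun y => gram g' (F x) (F y)) x := hG.comp x hF
  have e1 : (fun y => g'.inner (F y) (s y) (s' y)) =ᶠ[𝓝 x] fun y =>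
      gram g' (F x) (F y) (coordAt I' (F x) (F y) (s y)) (coordAt I' (F x) (F y) (s' y)) := by
    filter_upwards [hF.continuousAt.preimage_mem_nhds
      ((trivializationAt E' (fun y : N => TangentSpace I' y) (F x)).open_baseSet.mem_nhds
      (mem_base (F x)))] with y hy
    simp [coordSymmAt_coordAt_of_mem hy]
  have e2 := mvfderiv_clm_apply₂ hA (mdiffAt_coord_along hs) (mdiffAt_coord_along hs') v
  set a := coordAt I' (F x) (F x) (s x) with ha
  set b := coordAt I' (F x) (F x) (s' x) with hb
  have hab : MDiffAt (fun z => gram g' (F x) z a b) (F x) :=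
    mdiffAt_metric g' (mdiffAt_coordSymm (F x) a) (mdiffAt_coordSymm (F x) b)
  -- With the coefficients frozen, the function factors through `F`, so its derivative is taken on
  -- the target, where `e4` applies metric compatibility to the frame fields.
  have e3 : d% (fun y => gram g' (F x) (F y) a b) x v =
      d% (fun z => gram g' (F x) z a b) (F x) (mfderiv I I' F x v) :=
    mfderiv_comp_apply x hab hF v
  have e4 := hcov.metric _ _ (F x) (mfderiv I I' F x v) (mdiffAt_coordSymm (F x) a)
    (mdiffAt_coordSymm (F x) b)
  have e5 : d% (fun y => g'.inner (F y) (s y) (s' y)) x = d% (fun y =>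
      gram g' (F x) (F y) (coordAt I' (F x) (F y) (s y)) (coordAt I' (F x) (F y) (s' y))) x := mvfderiv_congr e1
  rw [e5, e2, e3]
  have e6 : d% (fun z => gram g' (F x) z a b) (F x) (mfderiv I I' F x v) = _ := e4
  rw [e6]
  simp only [gram, pullbackCov, ha, hb, coordSymmAt_coordAt]
  simp [coordSymmAt_coordAt]
  ring

/-- The pullback of a torsion-free connection is torsion-free. -/
theorem pullbackCov_torsion [IsManifold I ∞ M] [I.Boundaryless] [I'.Boundaryless]
    {cov : CovariantDerivative I' E' (fun y : N => TangentSpace I' y)}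
    (hcov : IsLeviCivita g' cov) {F : M → N} (hF : ContMDiff I I' ∞ F) {x : M}
    {X Y : Π x : M, TangentSpace I x} (hX : MDiffAt (T% X) x) (hY : MDiffAt (T% Y) x) :
    pullbackCov I cov F (fun y => mfderiv I I' F y (Y y)) x (X x) -
      pullbackCov I cov F (fun y => mfderiv I I' F y (X y)) x (Y x) =
      mfderiv I I' F x (mlieBracket I X Y x) := by
  set p := F x with hp
  set φ := extChartAt I' p with hφ
  have hsrc : (chartAt H' p).source ∈ 𝓝 p := chart_source_mem_nhds H' p
  -- The coordinates of F_* Z are the derivatives of φ ∘ F along Z. Hence the derivative parts of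
  -- the two pullback terms differ by the commutator formula for φ ∘ F.
  have hc : ∀ Z : Π x : M, TangentSpace I x,
      (fun y => coordAt I' p (F y) (mfderiv I I' F y (Z y))) =ᶠ[𝓝 x]
        fun y => d% (φ ∘ F) y (Z y) := by
    intro Z
    filter_upwards [hF.continuous.continuousAt.preimage_mem_nhds hsrc] with y hy
    rw [coordAt_eq_mfderiv hy]
    exact (mfderiv_comp_apply y (mdifferentiableAt_extChartAt hy)
      (hF.mdifferentiable (by simp) y) (Z y)).symm
  have hcd : ∀ Z : Π x : M, TangentSpace I x,
      d% (fun y => coordAt I' p (F y) (mfderiv I I' F y (Z y))) x =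
        d% (fun y => d% (φ ∘ F) y (Z y)) x :=
    fun Z => mvfderiv_congr (hc Z)
  have hφs : ContMDiffAt I' 𝓘(ℝ, E') ∞ φ p := contMDiffAt_extChartAt
  have h1 := mvfderiv_mlieBracket (f := φ ∘ F) ((hφs.comp x (hF x)).of_le (by decide)) hX hY
  rw [← hcd, ← hcd] at h1
  have h2 : d% (φ ∘ F) x (mlieBracket I X Y x) =
      coordAt I' p p (mfderiv I I' F x (mlieBracket I X Y x)) := by
    rw [coordAt_eq_mfderiv (mem_chart_source H' p)]
    exact mfderiv_comp_apply x (mdifferentiableAt_extChartAt (mem_chart_source H' p))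
      (hF.mdifferentiable (by simp) x) _
  -- Coordinate fields commute: φ has constant derivative along each, so dφ kills their bracket.
  -- Zero torsion then makes the connection parts of the two pullback terms equal, and they cancel.
  have hfl : ∀ a b : E', mlieBracket I' (fun z => coordSymmAt I' p z a)
      (fun z => coordSymmAt I' p z b) p = 0 := by
    intro a b
    have h3 := mvfderiv_mlieBracket (hφs.of_le (by decide)) (mdiffAt_coordSymm p a)
      (mdiffAt_coordSymm p b)
    have h6 : ∀ b : E', d% (fun y => d% φ y (coordSymmAt I' p y b)) p = 0 := by
      intro b
      have : (fun y => d% φ y (coordSymmAt I' p y b)) =ᶠ[𝓝 p] fun _ => b := by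
        filter_upwards [hsrc, coordAt_coordSymmAt (I' := I') p b] with y hy hb
        rw [coordAt_eq_mfderiv hy] at hb
        exact hb
      rw [mvfderiv_congr this, mvfderiv_const]
    rw [h6, h6] at h3
    have h7 : coordAt I' p p (mlieBracket I' (fun z => coordSymmAt I' p z a)
        (fun z => coordSymmAt I' p z b) p) = 0 := by
      rw [coordAt_eq_mfderiv (mem_chart_source H' p)]
      exact h3.trans (by simp)
    have h8 := congrArg (coordSymmAt I' p p) h7
    rwa [coordSymmAt_coordAt, map_zero] at h8
  have h4 := hcov.torsion_free _ _ p
    (mdiffAt_coordSymm p (coordAt I' p p (mfderiv I I' F x (X x))))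
    (mdiffAt_coordSymm p (coordAt I' p p (mfderiv I I' F x (Y x))))
  rw [hfl, coordSymmAt_coordAt, coordSymmAt_coordAt] at h4
  have h5 := congrArg (coordSymmAt I' p p) (h2.symm.trans h1)
  rw [coordSymmAt_coordAt, map_sub] at h5
  rw [h5]
  simp only [pullbackCov, add_apply, ContinuousLinearMap.comp_apply]
  rw [sub_eq_zero] at h4
  rw [h4]
  abel

end PullbackConnection

/-! ### Smoothness tested by inner products, and extension of tangent vectors -/

section Riesz

variable {E : Type*} [NormedAddCommGroup E] [NormedSpace ℝ E] [FiniteDimensional ℝ E]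
  {H : Type*} [TopologicalSpace H] {I : ModelWithCorners ℝ E H}
  {M : Type*} [TopologicalSpace M] [ChartedSpace H M] [IsManifold I ∞ M]
  {g : ContMDiffRiemannianMetric I ∞ E (fun x : M => TangentSpace I x)}

/-- Positive definiteness gives injectivity, and `E` has the same dimension as its dual. -/
theorem isInvertible_gram {p y : M}
    (hy : y ∈ (trivializationAt E (fun y : M => TangentSpace I y) p).baseSet) :
    (gram g p y).IsInvertible := by
  have hinj : Function.Injective (gram g p y : E →ₗ[ℝ] (E →L[ℝ] ℝ)) := by
    rw [← LinearMap.ker_eq_bot, LinearMap.ker_eq_bot']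
    intro a ha
    have h1 : g.inner y (coordSymmAt I p y a) (coordSymmAt I p y a) = 0 :=
      DFunLike.congr_fun ha a
    have h2 : coordSymmAt I p y a = 0 := by
      by_contra hne
      exact (g.pos y _ hne).ne' h1
    have h3 : coordAt I p y (coordSymmAt I p y a) = a :=
      Trivialization.continuousLinearMapAt_symmL _ hy a
    rw [← h3, h2, map_zero]
  have hfr : Module.finrank ℝ E = Module.finrank ℝ (E →L[ℝ] ℝ) := by
    rw [← (LinearMap.toContinuousLinearMap (𝕜 := ℝ) (E := E) (F' := ℝ)).finrank_eq]
    exact (Subspace.dual_finrank_eq (K := ℝ) (V := E)).symm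
  refine ⟨(LinearEquiv.ofInjectiveOfFinrankEq _ hinj hfr).toContinuousLinearEquiv, ?_⟩
  ext a b
  rfl

/-- A vector field whose inner products with all smooth fields are smooth is smooth. -/
theorem contMDiffAt_of_inner {W : Π x : M, TangentSpace I x} {x : M}
    (hW : ∀ Z : Π x : M, TangentSpace I x, ContMDiffAt I I.tangent ∞ (T% Z) x →
      ContMDiffAt I 𝓘(ℝ) ∞ (fun y => g.inner y (W y) (Z y)) x) :
    ContMDiffAt I I.tangent ∞ (T% W) x := by
  -- The covector dual to W, in coordinates. It is smooth by hypothesis, and the coordinates of W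
  -- are the inverse Gram map applied to it; inversion is smooth at invertible maps.
  let α : M → E →L[ℝ] ℝ := fun y => (g.inner y (W y)).comp (coordSymmAt I x y)
  have hα : ContMDiffAt I 𝓘(ℝ, E →L[ℝ] ℝ) ∞ α x :=
    contMDiffAt_clm_of_apply fun e => hW _ (contMDiffAt_coordSymm x e)
  have hinv : ContMDiffAt I 𝓘(ℝ, (E →L[ℝ] ℝ) →L[ℝ] E) ∞ (fun y => (gram g x y).inverse) x :=
    ((isInvertible_gram (mem_base x)).contDiffAt_map_inverse).contMDiffAt.comp x (contMDiffAt_gram x)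
  refine contMDiffAt_totalSpace.2 ⟨contMDiffAt_id, (hinv.clm_apply hα).congr_of_eventuallyEq ?_⟩
  filter_upwards [(trivializationAt E (fun y : M => TangentSpace I y) x).open_baseSet.mem_nhds
    (mem_base x)] with y hy
  have h1 : gram g x y (coordAt I x y (W y)) = α y := by
    ext b
    simp [α, coordSymmAt_coordAt_of_mem hy]
  rw [← h1]
  have h2 := DFunLike.congr_fun (isInvertible_gram (g := g) hy).inverse_comp_self (coordAt I x y (W y))
  refine Eq.trans ?_ h2.symm
  exact (Trivialization.continuousLinearMapAt_apply_of_mem _ _ hy _).symm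

/-- Every tangent vector is the value of a smooth vector field. -/
theorem exists_isSmoothField_eq [T2Space M] {x : M} (v : TangentSpace I x) :
    ∃ X : Π x : M, TangentSpace I x, IsSmoothField X ∧ X x = v := by
  obtain ⟨s, hs, hsm⟩ := FiberBundle.exists_contMDiffOn_extend (k := ∞) I E v
  -- A bump function supported where the local extension is smooth cuts it off to a global field
  -- without changing its value at x.
  obtain ⟨f, -, hf⟩ := (SmoothBumpFunction.nhds_basis_tsupport (I := I) x).mem_iff.1
    (interior_mem_nhds.2 hs)
  refine ⟨(f : M → ℝ) • FiberBundle.extend E v, fun y => ?_, by simp⟩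
  by_cases hy : y ∈ tsupport f
  · exact f.contMDiffAt.smul_section (hsm.contMDiffAt (mem_interior_iff_mem_nhds.1 (hf hy)))
  · refine (contMDiff_zeroSection ℝ _ y).congr_of_eventuallyEq ?_
    filter_upwards [(isClosed_tsupport f).isOpen_compl.mem_nhds hy] with z hz
    simp [image_eq_zero_of_notMem_tsupport hz, zeroSection]

end Riesz

/-! ### Projections, and smoothness of the dilation and of the splitting -/

section Submersion

variable {E : Type*} [NormedAddCommGroup E] [NormedSpace ℝ E] [FiniteDimensional ℝ E]
  {H : Type*} [TopologicalSpace H] {I : ModelWithCorners ℝ E H}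
  {M : Type*} [TopologicalSpace M] [ChartedSpace H M] [IsManifold I ∞ M]
  {E' : Type*} [NormedAddCommGroup E'] [NormedSpace ℝ E'] [FiniteDimensional ℝ E']
  {H' : Type*} [TopologicalSpace H'] {I' : ModelWithCorners ℝ E' H'}
  {N : Type*} [TopologicalSpace N] [ChartedSpace H' N] [IsManifold I' ∞ N]
  {g : ContMDiffRiemannianMetric I ∞ E (fun x : M => TangentSpace I x)}
  {g' : ContMDiffRiemannianMetric I' ∞ E' (fun y : N => TangentSpace I' y)}
  {F : M → N} {x : M}

theorem mem_vert {v : TangentSpace I x} : v ∈ vert I I' F x ↔ mfderiv I I' F x v = 0 :=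
  LinearMap.mem_ker

theorem vproj_mem (v : TangentSpace I x) : vproj I' g F x v ∈ vert I I' F x :=
  Submodule.projection_apply_mem _ v

theorem hproj_mem (v : TangentSpace I x) : hproj I' g F x v ∈ horiz I' g F x :=
  Submodule.projection_apply_mem _ v

theorem vproj_of_mem_vert {v : TangentSpace I x} (hv : v ∈ vert I I' F x) :
    vproj I' g F x v = v :=
  (Submodule.projection_eq_self_iff _ v).2 hv

theorem hproj_of_mem_horiz {v : TangentSpace I x} (hv : v ∈ horiz I' g F x) :
    hproj I' g F x v = v :=
  (Submodule.projection_eq_self_iff _ v).2 hv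

theorem hproj_eq_zero_iff {v : TangentSpace I x} : hproj I' g F x v = 0 ↔ v ∈ vert I I' F x :=
  Submodule.projection_apply_eq_zero_iff _

theorem vproj_eq_zero_iff {v : TangentSpace I x} : vproj I' g F x v = 0 ↔ v ∈ horiz I' g F x :=
  Submodule.projection_apply_eq_zero_iff _

theorem vproj_add_hproj (v : TangentSpace I x) : vproj I' g F x v + hproj I' g F x v = v :=
  Submodule.projection_add_projection_eq_self _ v

theorem mfderiv_vproj (v : TangentSpace I x) : mfderiv I I' F x (vproj I' g F x v) = 0 :=
  mem_vert.1 (vproj_mem v)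

theorem mfderiv_hproj (v : TangentSpace I x) :
    mfderiv I I' F x (hproj I' g F x v) = mfderiv I I' F x v := by
  conv_rhs => rw [← vproj_add_hproj (I' := I') (g := g) (F := F) v, map_add, mfderiv_vproj, zero_add]

theorem inner_hproj_left (v : TangentSpace I x) {w : TangentSpace I x} (hw : w ∈ horiz I' g F x) :
    g.inner x (hproj I' g F x v) w = g.inner x v w := by
  conv_rhs => rw [← vproj_add_hproj (I' := I') (g := g) (F := F) v]
  rw [map_add, add_apply, hw _ (vproj_mem v), zero_add]

theorem contMDiffAt_mfderiv_apply (hF : ContMDiff I I' ∞ F) {X : Π x : M, TangentSpace I x}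
    (hX : ContMDiffAt I I.tangent ∞ (T% X) x) :
    ContMDiffAt I I'.tangent ∞ (fun y => (⟨F y, mfderiv I I' F y (X y)⟩ : TangentBundle I' N)) x :=
  ((hF.contMDiff_tangentMap (m := ∞) (by simp)) _).comp x hX

theorem mdifferentiableAt_mfderiv_apply (hF : ContMDiff I I' ∞ F) {X : Π x : M, TangentSpace I x}
    (hX : MDiffAt (T% X) x) : MDifferentiableAt I I'.tangent
      (fun y => (⟨F y, mfderiv I I' F y (X y)⟩ : TangentBundle I' N)) x :=
  MDifferentiableAt.comp x
    ((hF.contMDiff_tangentMap (m := 1) (by decide)).mdifferentiable (by simp) _) hX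

namespace IsHorizontallyConformalSubmersion

variable {lam : M → ℝ}

/-- The source of all regularity below: the right side is smooth for smooth fields without any
knowledge of `lam` or the projection. -/
theorem sq_mul_inner_hproj (hF : IsHorizontallyConformalSubmersion g g' F lam)
    (v w : TangentSpace I x) : lam x ^ 2 * g.inner x (hproj I' g F x v) w =
      g'.inner (F x) (mfderiv I I' F x v) (mfderiv I I' F x w) := by
  rw [← mfderiv_hproj (g := g) v, ← mfderiv_hproj (g := g) w,
    hF.conformal x _ (hproj_mem v) _ (hproj_mem w), g.symm x (hproj I' g F x v) (hproj I' g F x w),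
    inner_hproj_left w (hproj_mem v), g.symm x w]

theorem contMDiffAt_sq_smul_hproj (hF : IsHorizontallyConformalSubmersion g g' F lam)
    {X : Π x : M, TangentSpace I x} (hX : ContMDiffAt I I.tangent ∞ (T% X) x) :
    ContMDiffAt I I.tangent ∞ (T% (fun y => lam y ^ 2 • hproj I' g F y (X y))) x := by
  refine contMDiffAt_of_inner (g := g) fun Z hZ => ?_
  refine (contMDiffAt_inner (g' := g') le_rfl (contMDiffAt_mfderiv_apply hF.smooth hX)
    (contMDiffAt_mfderiv_apply hF.smooth hZ)).congr_of_eventuallyEq (.of_forall fun y => ?_)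
  simp [hF.sq_mul_inner_hproj]

/-- For a local field X extending v, lam² is the quotient of g'(F_*(lam² H X), F_* X) by g'(F_* X,
F_* X): smooth functions with nonzero denominator near x. -/
theorem contMDiffAt_sq_dilation (hF : IsHorizontallyConformalSubmersion g g' F lam)
    {v : TangentSpace I x} (hv : mfderiv I I' F x v ≠ 0) :
    ContMDiffAt I 𝓘(ℝ) ∞ (fun y => lam y ^ 2) x := by
  have hX := FiberBundle.contMDiffAt_extend (k := ∞) I E v
  set X := FiberBundle.extend E v with hXdef
  have h1 := contMDiffAt_mfderiv_apply hF.smooth hX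
  have h2 := contMDiffAt_mfderiv_apply hF.smooth (hF.contMDiffAt_sq_smul_hproj hX)
  have hne : g'.inner (F x) (mfderiv I I' F x (X x)) (mfderiv I I' F x (X x)) ≠ 0 := by
    rw [hXdef, FiberBundle.extend_apply_self]
    exact (g'.pos _ _ hv).ne'
  have h4 := contMDiffAt_inner (g' := g') le_rfl h1 h1
  refine ((contMDiffAt_inner (g' := g') le_rfl h2 h1).div₀ h4 hne).congr_of_eventuallyEq ?_
  filter_upwards [h4.continuousAt.eventually_ne hne] with y hy
  rw [Pi.div_apply, map_smul, mfderiv_hproj, map_smul, smul_apply, smul_eq_mul, mul_div_cancel_right₀ _ hy]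

theorem contMDiffAt_dilation (hF : IsHorizontallyConformalSubmersion g g' F lam)
    {v : TangentSpace I x} (hv : mfderiv I I' F x v ≠ 0) :
    ContMDiffAt I 𝓘(ℝ) ∞ lam x := by
  have h := (Real.contDiffAt_sqrt (n := ∞) (pow_pos (hF.dilation_pos x) 2).ne').contMDiffAt.comp x
    (hF.contMDiffAt_sq_dilation hv)
  refine h.congr_of_eventuallyEq (.of_forall fun y => ?_)
  simp [Real.sqrt_sq (hF.dilation_pos y).le]

/-- Divide the smooth field lam² H X by the smooth positive function lam². -/
theorem contMDiffAt_hproj (hF : IsHorizontallyConformalSubmersion g g' F lam)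
    {X : Π x : M, TangentSpace I x} (hX : ContMDiffAt I I.tangent ∞ (T% X) x) :
    ContMDiffAt I I.tangent ∞ (T% (fun y => hproj I' g F y (X y))) x := by
  -- Over a zero-dimensional target conformality does not constrain `lam`, which may fail to be
  -- smooth, but then every vector is vertical.
  rcases subsingleton_or_nontrivial E' with hE | hE
  · have h0 : ∀ y, hproj I' g F y (X y) = 0 := fun y =>
      hproj_eq_zero_iff.2 (mem_vert.2 (hE.elim _ _))
    simp only [h0]
    exact contMDiff_zeroSection ℝ _ x
  · obtain ⟨e, he⟩ := exists_ne (0 : E')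
    obtain ⟨v, hv⟩ := hF.surjective x e
    have h1 := hF.contMDiffAt_sq_dilation (v := v) (by rw [hv]; exact he)
    have h2 := (h1.inv₀ (pow_pos (hF.dilation_pos x) 2).ne').smul_section
      (hF.contMDiffAt_sq_smul_hproj hX)
    refine h2.congr_of_eventuallyEq (.of_forall fun y => ?_)
    simp [(hF.dilation_pos y).ne']

theorem contMDiffAt_vproj (hF : IsHorizontallyConformalSubmersion g g' F lam)
    {X : Π x : M, TangentSpace I x} (hX : ContMDiffAt I I.tangent ∞ (T% X) x) :
    ContMDiffAt I I.tangent ∞ (T% (fun y => vproj I' g F y (X y))) x := by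
  refine (hX.sub_section (hF.contMDiffAt_hproj hX)).congr_of_eventuallyEq (.of_forall fun y => ?_)
  simp [eq_sub_of_add_eq (vproj_add_hproj (I' := I') (g := g) (F := F) (X y))]

end IsHorizontallyConformalSubmersion

end Submersion

/-! ### The second fundamental form and the totally geodesic criterion -/

section SecondFundamentalForm

variable {E : Type*} [NormedAddCommGroup E] [NormedSpace ℝ E] [FiniteDimensional ℝ E]
  {H : Type*} [TopologicalSpace H] {I : ModelWithCorners ℝ E H}
  {M : Type*} [TopologicalSpace M] [ChartedSpace H M] [IsManifold I ∞ M]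
  {E' : Type*} [NormedAddCommGroup E'] [NormedSpace ℝ E'] [FiniteDimensional ℝ E']
  {H' : Type*} [TopologicalSpace H'] {I' : ModelWithCorners ℝ E' H'}
  {N : Type*} [TopologicalSpace N] [ChartedSpace H' N] [IsManifold I' ∞ N]
  {g : ContMDiffRiemannianMetric I ∞ E (fun x : M => TangentSpace I x)}
  {g' : ContMDiffRiemannianMetric I' ∞ E' (fun y : N => TangentSpace I' y)}
  {F : M → N} {lam : M → ℝ} {x : M}

theorem IsSmoothField.mdiffAt {X : Π x : M, TangentSpace I x} (hX : IsSmoothField X) :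
    MDiffAt (T% X) x :=
  (hX x).mdifferentiableAt (by simp)

theorem pullbackCov_zero (cov : CovariantDerivative I' E' (fun y : N => TangentSpace I' y)) :
    pullbackCov I cov F (fun _ => 0) x = 0 := by
  have h : (fun z => coordSymmAt I' (F x) z (coordAt I' (F x) (F x) 0)) = 0 := by ext z; simp
  rw [pullbackCov, h, cov.zero]
  simp [mvfderiv_const]

/-- Antisymmetrizing either term in X and Y gives F_*[X, Y], as both connections are torsion-free.
-/
theorem secondFundamentalForm_symm [I.Boundaryless] [I'.Boundaryless] (hF : ContMDiff I I' ∞ F)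
    {X Y : Π x : M, TangentSpace I x} (hX : MDiffAt (T% X) x) (hY : MDiffAt (T% Y) x) :
    secondFundamentalForm g g' F X Y x = secondFundamentalForm g g' F Y X x := by
  have h1 := pullbackCov_torsion (leviCivita_spec (g := g')) hF hX hY
  rw [← (leviCivita_spec (g := g)).torsion_free X Y x hX hY, map_sub] at h1
  rw [secondFundamentalForm, secondFundamentalForm, sub_eq_sub_iff_sub_eq_sub]
  exact h1

theorem secondFundamentalForm_of_isVertical (X : Π x : M, TangentSpace I x)
    {Y : Π x : M, TangentSpace I x} (hY : IsVertical I' F Y) :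
    secondFundamentalForm g g' F X Y x = -mfderiv I I' F x (leviCivita g Y x (X x)) := by
  have h : (fun y => mfderiv I I' F y (Y y)) = fun _ => 0 := funext fun y => mem_vert.1 (hY y)
  rw [secondFundamentalForm, h, pullbackCov_zero]
  simp

theorem secondFundamentalForm_add_right (hF : ContMDiff I I' ∞ F) (X : Π x : M, TangentSpace I x)
    {Y Y' : Π x : M, TangentSpace I x} (hY : MDiffAt (T% Y) x) (hY' : MDiffAt (T% Y') x) :
    secondFundamentalForm g g' F X (Y + Y') x =
      secondFundamentalForm g g' F X Y x + secondFundamentalForm g g' F X Y' x := by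
  have h1 := pullbackCov_add (leviCivita g') (mdifferentiableAt_mfderiv_apply hF hY)
    (mdifferentiableAt_mfderiv_apply hF hY')
  simp only [secondFundamentalForm, Pi.add_apply, map_add, h1, add_apply,
    (leviCivita g).isCovariantDerivativeOnUniv.add hY hY']
  abel

theorem secondFundamentalForm_add_left (X X' Y : Π x : M, TangentSpace I x) :
    secondFundamentalForm g g' F (X + X') Y x =
      secondFundamentalForm g g' F X Y x + secondFundamentalForm g g' F X' Y x := by
  simp only [secondFundamentalForm, Pi.add_apply, map_add]
  abel

/-- Conformality needs only one horizontal argument, so it applies to covariant derivatives, which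
need not be horizontal. -/
theorem mfderiv_inner_of_isHorizontal (hF : IsHorizontallyConformalSubmersion g g' F lam)
    (v : TangentSpace I x) {w : TangentSpace I x} (hw : w ∈ horiz I' g F x) :
    g'.inner (F x) (mfderiv I I' F x v) (mfderiv I I' F x w) = lam x ^ 2 * g.inner x v w := by
  rw [← hF.sq_mul_inner_hproj, inner_hproj_left v hw]

/-- The defect of the second fundamental form of a horizontally conformal submersion from being
skew-symmetric in its last two arguments is given by the derivative of the dilation. -/
theorem IsHorizontallyConformalSubmersion.inner_secondFundamentalForm
    (hF : IsHorizontallyConformalSubmersion g g' F lam) (hlam : MDiffAt lam x)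
    (X : Π x : M, TangentSpace I x) {Y Z : Π x : M, TangentSpace I x}
    (hY : MDiffAt (T% Y) x) (hZ : MDiffAt (T% Z) x)
    (hYh : IsHorizontal I' g F Y) (hZh : IsHorizontal I' g F Z) :
    g'.inner (F x) (secondFundamentalForm g g' F X Y x) (mfderiv I I' F x (Z x)) +
      g'.inner (F x) (mfderiv I I' F x (Y x)) (secondFundamentalForm g g' F X Z x) =
      2 * lam x * d% lam x (X x) * g.inner x (Y x) (Z x) := by
  have h1 := pullbackCov_inner (leviCivita_spec (g := g'))
    (mdifferentiableAt_mfderiv_apply hF.smooth hY) (mdifferentiableAt_mfderiv_apply hF.smooth hZ)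
    (X x)
  have h2 : (fun y => g'.inner (F y) (mfderiv I I' F y (Y y)) (mfderiv I I' F y (Z y))) =
      fun y => (lam y * lam y) * g.inner y (Y y) (Z y) := by
    funext y
    rw [mfderiv_inner_of_isHorizontal hF _ (hZh y), sq]
  have hsq : MDiffAt (fun y => lam y * lam y) x := hlam.mul hlam
  rw [h2, mvfderiv_fun_mul hsq (mdiffAt_metric g hY hZ), mvfderiv_fun_mul hlam hlam] at h1
  have h3 := (leviCivita_spec (g := g)).metric Y Z x (X x) hY hZ
  have h4 := mfderiv_inner_of_isHorizontal hF (leviCivita g Y x (X x)) (hZh x)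
  have h5 := mfderiv_inner_of_isHorizontal hF (leviCivita g Z x (X x)) (hYh x)
  rw [g'.symm] at h5
  rw [g.symm x (Y x)] at h3
  simp only [secondFundamentalForm, map_sub, sub_apply, h4, h5]
  simp only [add_apply, smul_apply, smul_eq_mul, h3] at h1
  linear_combination -h1

variable (I') in
/-- The vertical distribution is parallel: covariant derivatives of vertical fields are vertical. -/
def IsVerticalParallel (g : ContMDiffRiemannianMetric I ∞ E (fun x : M => TangentSpace I x))
    (F : M → N) : Prop :=
  ∀ X W : Π x : M, TangentSpace I x, IsSmoothField X → IsSmoothField W → IsVertical I' F W →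
    ∀ x, leviCivita g W x (X x) ∈ vert I I' F x

/-- A horizontally conformal submersion is totally geodesic if and only if its vertical distribution
is parallel and it is horizontally homothetic. -/
theorem IsHorizontallyConformalSubmersion.isTotallyGeodesic_iff [I.Boundaryless] [I'.Boundaryless]
    [T2Space M] (hF : IsHorizontallyConformalSubmersion g g' F lam) :
    IsTotallyGeodesic g g' F ↔
      IsVerticalParallel I' g F ∧ IsHorizontallyHomothetic I' g F lam := by
  have hH : ∀ {X : Π x : M, TangentSpace I x}, IsSmoothField X →
    IsSmoothField (fun y => hproj I' g F y (X y)) := fun hX y => hF.contMDiffAt_hproj (hX y)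
  have hV : ∀ {X : Π x : M, TangentSpace I x}, IsSmoothField X →
    IsSmoothField (fun y => vproj I' g F y (X y)) := fun hX y => hF.contMDiffAt_vproj (hX y)
  constructor
  · refine fun h => ⟨fun X W hX hW hWv x => ?_, fun x v hv => ?_⟩
    · have h1 := h X W hX hW x
      rwa [secondFundamentalForm_of_isVertical X hWv, neg_eq_zero] at h1
    · by_cases hv0 : v = 0
      · rw [hv0, map_zero]
      -- A nonzero horizontal vector is not killed by the differential, which makes `lam`
      -- differentiable at x. The skewness identity with all three fields equal to H X then reads 0
      -- = 2 lam (v lam) g(v, v).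
      have hFv : mfderiv I I' F x v ≠ 0 := fun h0 =>
        hv0 ((hproj_of_mem_horiz hv).symm.trans (hproj_eq_zero_iff.2 (mem_vert.2 h0)))
      obtain ⟨X, hX, rfl⟩ := exists_isSmoothField_eq v
      have h1 := hF.inner_secondFundamentalForm
        ((hF.contMDiffAt_dilation hFv).mdifferentiableAt (by simp))
        (fun y => hproj I' g F y (X y)) (hH hX).mdiffAt (hH hX).mdiffAt
        (fun y => hproj_mem (X y)) (fun y => hproj_mem (X y))
      rw [h _ _ (hH hX) (hH hX) x, hproj_of_mem_horiz hv] at h1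
      have h2 := (g.pos x _ hv0).ne'
      have h3 := (hF.dilation_pos x).ne'
      simpa [h2, h3] using h1.symm
  · rintro ⟨hpar, hhom⟩ X Y hX hY x
    have hvert : ∀ X W : Π x : M, TangentSpace I x, IsSmoothField X → IsSmoothField W →
        IsVertical I' F W → secondFundamentalForm g g' F X W x = 0 := by
      intro X W hX hW hWv
      rw [secondFundamentalForm_of_isVertical X hWv, mem_vert.1 (hpar X W hX hW hWv x), neg_zero]
    have hsymm : ∀ X Y : Π x : M, TangentSpace I x, IsSmoothField X → IsSmoothField Y →
        secondFundamentalForm g g' F X Y x = secondFundamentalForm g g' F Y X x :=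
      fun X Y hX hY => secondFundamentalForm_symm hF.smooth hX.mdiffAt hY.mdiffAt
    have hhoriz : secondFundamentalForm g g' F (fun y => hproj I' g F y (X y))
        (fun y => hproj I' g F y (Y y)) x = 0 := by
      refine metric_ext (g := g') fun w => ?_
      obtain ⟨z, rfl⟩ := hF.surjective x w
      -- A test vector with zero image is trivial; any other supplies the differentiability of `lam`
      -- at x.
      by_cases hz : mfderiv I I' F x z = 0
      · rw [hz, map_zero, map_zero]
      have hlam := (hF.contMDiffAt_dilation hz).mdifferentiableAt (n := ∞) (by simp)
      obtain ⟨Z, hZ, rfl⟩ := exists_isSmoothField_eq z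
      have hskew : ∀ A B C : Π x : M, TangentSpace I x, IsSmoothField A → IsSmoothField B →
          IsSmoothField C → IsHorizontal I' g F A → IsHorizontal I' g F B →
          IsHorizontal I' g F C →
          g'.inner (F x) (secondFundamentalForm g g' F A B x) (mfderiv I I' F x (C x)) =
            -g'.inner (F x) (secondFundamentalForm g g' F A C x) (mfderiv I I' F x (B x)) := by
        intro A B C hA hB hC hAh hBh hCh
        have h1 := hF.inner_secondFundamentalForm hlam A hB.mdiffAt hC.mdiffAt hBh hCh
        rw [hhom x _ (hAh x), g'.symm _ (mfderiv I I' F x (B x))] at h1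
        linear_combination h1
      have hXh : IsHorizontal I' g F (fun y => hproj I' g F y (X y)) := fun y => hproj_mem (X y)
      have hYh : IsHorizontal I' g F (fun y => hproj I' g F y (Y y)) := fun y => hproj_mem (Y y)
      have hZh : IsHorizontal I' g F (fun y => hproj I' g F y (Z y)) := fun y => hproj_mem (Z y)
      -- The three cyclic instances of skewness, combined with symmetry, give B(X, Y, Z) = -B(X, Y,
      -- Z).
      have e1 := hskew _ _ _ (hH hX) (hH hY) (hH hZ) hXh hYh hZh
      have e2 := hskew _ _ _ (hH hZ) (hH hX) (hH hY) hZh hXh hYh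
      have e3 := hskew _ _ _ (hH hY) (hH hZ) (hH hX) hYh hZh hXh
      rw [hsymm _ _ (hH hX) (hH hZ)] at e1
      rw [hsymm _ _ (hH hZ) (hH hY)] at e2
      rw [hsymm _ _ (hH hY) (hH hX)] at e3
      have e4 : mfderiv I I' F x (hproj I' g F x (Z x)) = mfderiv I I' F x (Z x) := mfderiv_hproj _
      rw [map_zero, zero_apply, ← e4]
      linarith
    have hsplit : ∀ X : Π x : M, TangentSpace I x,
        X = (fun y => vproj I' g F y (X y)) + fun y => hproj I' g F y (X y) :=
      fun X => funext fun y => (vproj_add_hproj (X y)).symm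
    rw [hsplit Y, secondFundamentalForm_add_right hF.smooth X (hV hY).mdiffAt (hH hY).mdiffAt,
      hvert X _ hX (hV hY) (fun y => vproj_mem (Y y)), zero_add, hsplit X,
      secondFundamentalForm_add_left, hsymm _ _ (hV hX) (hH hY),
      hvert _ _ (hH hY) (hV hX) (fun y => vproj_mem (X y)), zero_add, hhoriz]

/-! ### Conditions (i) and (iii) for a parallel complex structure -/

variable {R : Π x : M, TangentSpace I x →L[ℝ] TangentSpace I x}

theorem capC_hproj_add_omega_vproj (z : TangentSpace I x) :
    capC I' g F R x (hproj I' g F x z) + omega I' g F R x (vproj I' g F x z) =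
      hproj I' g F x (R x z) := by
  simp only [capC, omega, LinearMap.comp_apply, hproj_of_mem_horiz (hproj_mem z),
    vproj_of_mem_vert (vproj_mem z)]
  rw [← map_add, add_comm]
  exact congrArg _ ((map_add (R x) _ _).symm.trans (congrArg _ (vproj_add_hproj z)))

/-- On a vertical W the two fields add up to R W, and R is parallel. Smoothness of the projections
is needed to differentiate the summands separately. -/
theorem leviCivita_phi_add_omega (hF : IsHorizontallyConformalSubmersion g g' F lam)
    (hR : IsSmoothEnd R) (hpar : IsParallelEnd g R) {W : Π x : M, TangentSpace I x}
    (hW : IsSmoothField W) (hWv : IsVertical I' F W) (v : TangentSpace I x) :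
    leviCivita g (fun y => phi I' g F R y (W y)) x v +
      leviCivita g (fun y => omega I' g F R y (W y)) x v = R x (leviCivita g W x v) := by
  have hRW : IsSmoothField (fun y => R y (W y)) := hR.clm_bundle_apply hW
  have h1 : ∀ y, phi I' g F R y (W y) = vproj I' g F y (R y (W y)) := fun y => by
    simp [phi, vproj_of_mem_vert (hWv y)]
  have h2 : ∀ y, omega I' g F R y (W y) = hproj I' g F y (R y (W y)) := fun y => by
    simp [omega, vproj_of_mem_vert (hWv y)]
  simp only [h1, h2]
  rw [← hpar W hW x v, ← add_apply, ← (leviCivita g).isCovariantDerivativeOnUniv.add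
    ((hF.contMDiffAt_vproj (hRW x)).mdifferentiableAt (by simp))
    ((hF.contMDiffAt_hproj (hRW x)).mdifferentiableAt (by simp))]
  congr 2
  exact funext fun y => vproj_add_hproj (R y (W y))

theorem vproj_phi (W : Π x : M, TangentSpace I x) :
    (fun y => vproj I' g F y (phi I' g F R y (W y))) = fun y => phi I' g F R y (W y) :=
  funext fun _ => vproj_of_mem_vert (vproj_mem _)

theorem hproj_phi (W : Π x : M, TangentSpace I x) :
    (fun y => hproj I' g F y (phi I' g F R y (W y))) = 0 :=
  funext fun _ => hproj_eq_zero_iff.2 (vproj_mem _)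

theorem hproj_omega (W : Π x : M, TangentSpace I x) :
    (fun y => hproj I' g F y (omega I' g F R y (W y))) = fun y => omega I' g F R y (W y) :=
  funext fun _ => hproj_of_mem_horiz (hproj_mem _)

theorem vproj_omega (W : Π x : M, TangentSpace I x) :
    (fun y => vproj I' g F y (omega I' g F R y (W y))) = 0 :=
  funext fun _ => vproj_eq_zero_iff.2 (hproj_mem _)

/-- One half of each `T` vanishes: `T_V φ_R W` is H ∇_V φ_R W and `T_V ω_R W` is V ∇_V ω_R W. So
`C_R` and `ω_R` act on the two components of R ∇_V W, and the result is H(R² ∇_V W). -/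
theorem verticalCondition_lhs (hF : IsHorizontallyConformalSubmersion g g' F lam)
    (hR : IsSmoothEnd R) (hsq : ∀ (x : M) (v : TangentSpace I x), R x (R x v) = -v)
    (hpar : IsParallelEnd g R) {V W : Π x : M, TangentSpace I x}
    (hV : IsVertical I' F V) (hW : IsSmoothField W) (hWv : IsVertical I' F W) :
    capC I' g F R x (tensorT I' g F V (fun y => phi I' g F R y (W y)) x +
        hNabla I' g F V (fun y => omega I' g F R y (W y)) x) +
      omega I' g F R x (vNabla I' g F V (fun y => phi I' g F R y (W y)) x +
        tensorT I' g F V (fun y => omega I' g F R y (W y)) x) =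
      -hproj I' g F x (leviCivita g W x (V x)) := by
  simp only [tensorT, hNabla, vNabla, vproj_phi, hproj_phi, hproj_omega, vproj_omega,
    vproj_of_mem_vert (hV x), (leviCivita g).zero, Pi.zero_apply, zero_apply, map_zero, add_zero,
    zero_add]
  rw [← map_add, ← map_add, capC_hproj_add_omega_vproj, leviCivita_phi_add_omega hF hR hpar hW hWv,
    hsq, map_neg]

/-- The same computation with a horizontal direction of differentiation, `A` playing the role of
`T`. -/
theorem mixedCondition_lhs (hF : IsHorizontallyConformalSubmersion g g' F lam)
    (hR : IsSmoothEnd R) (hsq : ∀ (x : M) (v : TangentSpace I x), R x (R x v) = -v)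
    (hpar : IsParallelEnd g R) {X V : Π x : M, TangentSpace I x}
    (hX : IsHorizontal I' g F X) (hV : IsSmoothField V) (hVv : IsVertical I' F V) :
    capC I' g F R x (tensorA I' g F X (fun y => phi I' g F R y (V y)) x +
        hNabla I' g F X (fun y => omega I' g F R y (V y)) x) +
      omega I' g F R x (vNabla I' g F X (fun y => phi I' g F R y (V y)) x +
        tensorA I' g F X (fun y => omega I' g F R y (V y)) x) =
      -hproj I' g F x (leviCivita g V x (X x)) := by
  simp only [tensorA, hNabla, vNabla, vproj_phi, hproj_phi, hproj_omega, vproj_omega,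
    hproj_of_mem_horiz (hX x), (leviCivita g).zero, Pi.zero_apply, zero_apply, map_zero, add_zero,
    zero_add]
  rw [← map_add, ← map_add, capC_hproj_add_omega_vproj, leviCivita_phi_add_omega hF hR hpar hV hVv,
    hsq, map_neg]

/-- For a parallel complex structure `R`, the vertical and mixed conditions together say that the
vertical distribution is parallel. -/
theorem isVerticalParallel_iff (hF : IsHorizontallyConformalSubmersion g g' F lam)
    (hR : IsSmoothEnd R) (hsq : ∀ (x : M) (v : TangentSpace I x), R x (R x v) = -v)
    (hpar : IsParallelEnd g R) :
    IsVerticalParallel I' g F ↔ VerticalCondition I' g F R ∧ MixedCondition I' g F R := by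
  constructor
  · refine fun h => ⟨fun V W hV hW hVv hWv x => ?_, fun V X hV hX hVv hXh x => ?_⟩
    · rw [verticalCondition_lhs hF hR hsq hpar hVv hW hWv, neg_eq_zero, hproj_eq_zero_iff]
      exact h V W hV hW hWv x
    · rw [mixedCondition_lhs hF hR hsq hpar hXh hV hVv, neg_eq_zero, hproj_eq_zero_iff]
      exact h X V hX hV hVv x
  · rintro ⟨hv, hm⟩ X W hX hW hWv x
    have h1 := hv _ W (fun y => hF.contMDiffAt_vproj (hX y)) hW (fun y => vproj_mem (X y)) hWv x
    have h2 := hm W _ hW (fun y => hF.contMDiffAt_hproj (hX y)) hWv (fun y => hproj_mem (X y)) x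
    rw [verticalCondition_lhs hF hR hsq hpar (fun y => vproj_mem (X y)) hW hWv, neg_eq_zero,
      hproj_eq_zero_iff] at h1
    rw [mixedCondition_lhs hF hR hsq hpar (fun y => hproj_mem (X y)) hW hWv, neg_eq_zero,
      hproj_eq_zero_iff] at h2
    -- The connection is linear in its direction, so the vertical and horizontal parts of X may be
    -- treated separately.
    rw [← vproj_add_hproj (I' := I') (g := g) (F := F) (X x), map_add]
    exact add_mem h1 h2

/-- A horizontally conformal submersion from a manifold with a parallel complex structure `R` is
totally geodesic if and only if it is horizontally homothetic and satisfies the vertical and mixed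
conditions for `R`. -/
theorem IsHorizontallyConformalSubmersion.isTotallyGeodesic_iff_conditions [I.Boundaryless]
    [I'.Boundaryless] [T2Space M] (hF : IsHorizontallyConformalSubmersion g g' F lam)
    (hR : IsSmoothEnd R) (hsq : ∀ (x : M) (v : TangentSpace I x), R x (R x v) = -v)
    (hpar : IsParallelEnd g R) :
    IsTotallyGeodesic g g' F ↔ VerticalCondition I' g F R ∧
      IsHorizontallyHomothetic I' g F lam ∧ MixedCondition I' g F R := by
  rw [hF.isTotallyGeodesic_iff, isVerticalParallel_iff hF hR hsq hpar]
  tauto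

end SecondFundamentalForm

end HSlant

end

theorem theorem3p18
    {EM : Type*} [NormedAddCommGroup EM] [NormedSpace ℝ EM] [FiniteDimensional ℝ EM]
    {HM : Type*} [TopologicalSpace HM] {IM : ModelWithCorners ℝ EM HM} [IM.Boundaryless]
    {M : Type*} [TopologicalSpace M] [ChartedSpace HM M] [IsManifold IM ∞ M] [T2Space M]
    [SecondCountableTopology M]
    {EN : Type*} [NormedAddCommGroup EN] [NormedSpace ℝ EN] [FiniteDimensional ℝ EN]
    {HN : Type*} [TopologicalSpace HN] {IN : ModelWithCorners ℝ EN HN} [IN.Boundaryless]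
    {N : Type*} [TopologicalSpace N] [ChartedSpace HN N] [IsManifold IN ∞ N] [T2Space N]
    [SecondCountableTopology N]
    (gM : ContMDiffRiemannianMetric IM ∞ EM (fun x : M => TangentSpace IM x))
    (gN : ContMDiffRiemannianMetric IN ∞ EN (fun y : N => TangentSpace IN y))
    (I J K : Π x : M, TangentSpace IM x →L[ℝ] TangentSpace IM x)
    (hIJK : IsHyperkahler gM I J K)
    (F : M → N) (lam : M → ℝ)
    (hF : IsHorizontallyConformalSubmersion gM gN F lam)
    (hslant : IsAlmostSlantBasis IN gM F I J K) :
    List.TFAE [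
      IsTotallyGeodesic gM gN F,
      VerticalCondition IN gM F I ∧ IsHorizontallyHomothetic IN gM F lam ∧
        MixedCondition IN gM F I,
      VerticalCondition IN gM F J ∧ IsHorizontallyHomothetic IN gM F lam ∧
        MixedCondition IN gM F J,
      VerticalCondition IN gM F K ∧ IsHorizontallyHomothetic IN gM F lam ∧
        MixedCondition IN gM F K] := by 
  have h : ∀ R ∈ ({I, J, K} : Set (Π x : M, TangentSpace IM x →L[ℝ] TangentSpace IM x)),
      IsTotallyGeodesic gM gN F ↔ VerticalCondition IN gM F R ∧
        IsHorizontallyHomothetic IN gM F lam ∧ MixedCondition IN gM F R := fun R hR =>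
    hF.isTotallyGeodesic_iff_conditions (hIJK.smooth R hR) (hIJK.sq_eq_neg R hR)
      (hIJK.parallel R hR)
  tfae_have 1 ↔ 2 := h I (by simp)
  tfae_have 1 ↔ 3 := h J (by simp)
  tfae_have 1 ↔ 4 := h K (by simp)
  tfae_finish
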